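/- \textbf{Theorem (Quasi-invariant curves).} Let $g:\mathbb R\to\mathbb R$ be the lift of an orientation-preserving analytic circle diffeomorphism: $g$ is an increasing real-analytic diffeomorphism of $\mathbb R$ and $g(x+1)=g(x)+1$. Assume that its rotation number $\alpha$ is irrational, and let $(p_n/q_n)_{n\ge 0}$ be the convergents of the continued fraction of $\alpha$. Let $\Delta>0$, $B_\Delta=\{z\in\mathbb C : |\operatorname{Im} z|<\Delta\}$, and assume that $g$ extends to a holomorphic diffeomorphism $g:\Omega\to\Omega'$ between open subsets of $\mathbb C$ that both contain $\{|\operatorname{Im} z|\le\Delta\}$ (so $g$ and $g^{-1}$ are defined on a neighbourhood of $\overline{B_\Delta}$), and that $$\|D\log Dg\|_{C^0(B_\Delta)}=\sup_{B_\Delta}\left|\frac{g''}{g'}\right|<\frac19 .$$ Let $E(z)=e^{2\pi i z}$ and $A_\Delta=E(B_\Delta)$, and denote again by $g$ the map $E(z)\mapsto E(g(z))$ induced on $A_\Delta$. Let $\mathbb D$ be the open unit disk, $\mathbb S^1=\partial\mathbb D$, let $d_P$ be the Poincar\'e distance of $\mathbb C\setminus\overline{\mathbb D}$, i.e. the quotient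 of the distance of the upper half-plane with metric $|d\zeta|/\operatorname{Im}\zeta$ by the universal covering $\zeta\mapsto E(-\zeta)$, and let $\mathcal D_P$ be the associated Hausdorff distance. Then for every $C_0>0$ there are $n_0\ge 0$ and Jordan curves $(\gamma_n)_{n\ge n_0}$, contained in $\mathbb C\setminus\overline{\mathbb D}$ and homotopic to $\mathbb S^1$ in $\mathbb C\setminus\mathbb D$, such that for all $n\ge n_0$: 1. all the iterates $g^j$, $0\le j\le q_n$, are defined on a neighbourhood of the closure of the annulus $U_n$ bounded by $\mathbb S^1$ and $\gamma_n$ (the points $z,g(z),\dots,g^{q_n-1}(z)$ stay in $A_\Delta$ for every $z$ in the neighbourhood); 2. $\mathcal D_P(g^j(\gamma_n),\gamma_n)\le C_0$ for all $0\le j\le q_n$; 3. $d_P(g^{q_n}(z),z)\le C_0$ for all $z\in\gamma_n$. -/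

import Mathlib

noncomputable section

namespace CircleDiffeo

/-- Elements of `D^ω(𝕋)`, written on the universal covering: real-analytic increasing diffeomorphisms
of the line that commute with `x ↦ x + 1`. Monotonicity and the commutation are part of Mathlib's
`CircleDeg1Lift`; the rotation number is Mathlib's `CircleDeg1Lift.translationNumber`. -/
structure IsAnalyticDiffeo (g : CircleDeg1Lift) : Prop where
  analytic : AnalyticOnNhd ℝ (fun x : ℝ => g x) Set.univ
  inverse : ∃ h : ℝ → ℝ, AnalyticOnNhd ℝ h Set.univ ∧
    (∀ x, h (g x) = x) ∧ (∀ x, g (h x) = x)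

/-- The strip `B_Δ = {|Im z| < Δ}`. -/
def strip (Δ : ℝ) : Set ℂ := {z | |z.im| < Δ}

/-- The closed strip `{|Im z| ≤ Δ}`, the closure of `B_Δ` for `Δ > 0`. -/
def closedStrip (Δ : ℝ) : Set ℂ := {z | |z.im| ≤ Δ}

/-- `G` is an extension of `g` to a holomorphic diffeomorphism `Ω → Ω'` between open sets, where both
`Ω` and `Ω'` contain the closed strip: `G` and its inverse are defined on a neighbourhood of it. -/
structure IsStripExtension (Δ : ℝ) (g : CircleDeg1Lift) (G : ℂ → ℂ) : Prop where
  agrees : ∀ x : ℝ, G (x : ℂ) = ((g x : ℝ) : ℂ)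
  diffeo : ∃ (Ω Ω' : Set ℂ) (H : ℂ → ℂ), IsOpen Ω ∧ IsOpen Ω' ∧
    closedStrip Δ ⊆ Ω ∧ closedStrip Δ ⊆ Ω' ∧
    DifferentiableOn ℂ G Ω ∧ DifferentiableOn ℂ H Ω' ∧
    Set.BijOn G Ω Ω' ∧ Set.InvOn H G Ω Ω'

/-- The `n`-th convergent denominator `q_n` of `α` (so `q_0 = 1`, `q_1 = a_1`): Mathlib's
`Real.convergent α n` is the rational number `p_n / q_n`, and `p_n / q_n` is in lowest terms. -/
def convDen (α : ℝ) (n : ℕ) : ℕ := (Real.convergent α n).den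

/-- `E(z) = exp (2 π i z)`. -/
def E (z : ℂ) : ℂ := Complex.exp (2 * Real.pi * Complex.I * z)

/-- The annulus `A_Δ = E(B_Δ)`. -/
def annulus (Δ : ℝ) : Set ℂ := E '' strip Δ

/-- The map induced by the lift `G` on the annulus: `E z ↦ E (G z)`; computed with the lift of `w`
given by the principal logarithm (any lift in the strip gives the same value, see
`annulusMap_E`). -/
def annulusMap (G : ℂ → ℂ) (w : ℂ) : ℂ := E (G (Complex.log w / (2 * Real.pi * Complex.I)))

/-- The bounded complementary domain of a Jordan curve with image `Γ`. -/
def jordanInterior (Γ : Set ℂ) : Set ℂ :=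
  {z | z ∉ Γ ∧ Bornology.IsBounded (connectedComponentIn Γᶜ z)}

/-- The inclusion of the unit circle `𝕊¹` in `ℂ`, as a loop. -/
def unitLoop : C(Circle, ℂ) := ⟨fun t => (t : ℂ), by fun_prop⟩

/-- `γ` parametrizes a Jordan curve in `ℂ ∖ 𝔻̄` that is homotopic to `𝕊¹`
(through loops in `ℂ ∖ 𝔻`). -/
structure IsExteriorJordanCurve (γ : C(Circle, ℂ)) : Prop where
  injective : Function.Injective γ
  exterior : ∀ t, 1 < ‖γ t‖
  homotopic : ContinuousMap.HomotopicWith γ unitLoop (fun f => ∀ t, 1 ≤ ‖f t‖)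

/-- The annulus bounded by `𝕊¹` and the Jordan curve with image `Γ`. -/
def annulusBelow (Γ : Set ℂ) : Set ℂ := jordanInterior Γ \ Metric.closedBall 0 1

/-- The Poincaré distance of `ℂ ∖ 𝔻̄`: the quotient of the distance of the upper half-plane
(metric `|dζ| / Im ζ`) by the holomorphic universal covering `ζ ↦ E (-ζ)`.
It is `∞` when one of the points is not in `ℂ ∖ 𝔻̄`. -/
def poincareEDist (z w : ℂ) : ENNReal :=
  ⨅ (ζ : UpperHalfPlane) (ξ : UpperHalfPlane) (_ : E (-(ζ : ℂ)) = z) (_ : E (-(ξ : ℂ)) = w),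
    edist ζ ξ

/-- The Hausdorff distance of two subsets of `ℂ ∖ 𝔻̄` for the Poincaré distance. -/
def poincareHausdorffEDist (A B : Set ℂ) : ENNReal :=
  max (⨆ a ∈ A, ⨅ b ∈ B, poincareEDist a b) (⨆ b ∈ B, ⨅ a ∈ A, poincareEDist a b)

theorem E_add_intCast (z : ℂ) (k : ℤ) : E (z + k) = E z := by
  unfold E
  rw [Complex.exp_eq_exp_iff_exists_int]
  exact ⟨k, by ring⟩

theorem IsStripExtension.add_one {Δ : ℝ} {g : CircleDeg1Lift} {G : ℂ → ℂ}
    (h : IsStripExtension Δ g G) {z : ℂ} (hz : z ∈ strip Δ) : G (z + 1) = G z + 1 := by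
  obtain ⟨Ω, Ω', H, hΩ, -, hs, -, hG, -⟩ := h.diffeo
  have hopen : IsOpen (strip Δ) := isOpen_lt (by fun_prop) continuous_const
  have hsub : ∀ w ∈ strip Δ, w ∈ Ω := fun w hw => hs (show |w.im| ≤ Δ from le_of_lt hw)
  have hd : ∀ w ∈ strip Δ, DifferentiableAt ℂ G w := fun w hw =>
    (hG w (hsub w hw)).differentiableAt (hΩ.mem_nhds (hsub w hw))
  have hsh : ∀ w ∈ strip Δ, w + 1 ∈ strip Δ := fun w hw => by simpa [strip] using hw
  have hΔ : 0 < Δ := lt_of_le_of_lt (abs_nonneg _) hz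
  have hconv : Convex ℝ (strip Δ) := by
    have : strip Δ = Complex.imLm ⁻¹' (Set.Ioo (-Δ) Δ) := by
      ext w; simp [strip, abs_lt]
    rw [this]
    exact (convex_Ioo _ _).linear_preimage _
  have h1 : AnalyticOnNhd ℂ (fun w => G (w + 1)) (strip Δ) := by
    refine DifferentiableOn.analyticOnNhd (fun w hw => ?_) hopen
    exact (DifferentiableAt.comp w (hd _ (hsh w hw))
      (by fun_prop : DifferentiableAt ℂ (fun w : ℂ => w + 1) w)).differentiableWithinAt
  have h2 : AnalyticOnNhd ℂ (fun w => G w + 1) (strip Δ) :=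
    DifferentiableOn.analyticOnNhd
      (fun w hw => ((hd w hw).add_const 1).differentiableWithinAt) hopen
  have h0 : (0 : ℂ) ∈ strip Δ := by simpa [strip] using hΔ
  refine h1.eqOn_of_preconnected_of_frequently_eq h2 hconv.isPreconnected h0 ?_ hz
  have ht : Filter.Tendsto (fun k : ℕ => (((1 / ((k : ℝ) + 1) : ℝ)) : ℂ)) Filter.atTop
      (nhdsWithin 0 {0}ᶜ) := by
    refine tendsto_nhdsWithin_iff.2 ⟨?_, Filter.Eventually.of_forall fun k => ?_⟩
    · have := (Complex.continuous_ofReal.tendsto 0).comp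
        (tendsto_one_div_add_atTop_nhds_zero_nat (𝕜 := ℝ))
      simpa [Function.comp_def] using this
    · simp only [Set.mem_compl_iff, Set.mem_singleton_iff, Complex.ofReal_eq_zero]
      positivity
  refine ht.frequently (Filter.Frequently.of_forall fun k => ?_)
  generalize (1 / ((k : ℝ) + 1) : ℝ) = x
  have := h.agrees (x + 1)
  rw [g.map_add_one] at this
  rw [h.agrees x]
  exact_mod_cast this

/-- `annulusMap G` is the map `E z ↦ E (G z)`, whatever lift `z` in the strip is used. -/
theorem annulusMap_E {Δ : ℝ} {g : CircleDeg1Lift} {G : ℂ → ℂ}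
    (h : IsStripExtension Δ g G) {z : ℂ} (hz : z ∈ strip Δ) :
    annulusMap G (E z) = E (G z) := by
  have hper : ∀ (k : ℕ) (w : ℂ), w ∈ strip Δ → G (w + k) = G w + k := by
    intro k
    induction k with
    | zero => intro w _; simp
    | succ k ih =>
      intro w hw
      have hw' : w + k ∈ strip Δ := by simpa [strip] using hw
      have := h.add_one hw'
      rw [ih w hw] at this
      push_cast
      rw [← add_assoc, this, add_assoc]
  have hπ : (2 * Real.pi * Complex.I : ℂ) ≠ 0 := Complex.two_pi_I_ne_zero
  obtain ⟨k, hk⟩ : ∃ k : ℤ, Complex.log (E z) = 2 * Real.pi * Complex.I * z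
      + k * (2 * Real.pi * Complex.I) := by
    rw [← Complex.exp_eq_exp_iff_exists_int, E, Complex.exp_log (Complex.exp_ne_zero _)]
  have hl : Complex.log (E z) / (2 * Real.pi * Complex.I) = z + k := by
    rw [hk, div_eq_iff hπ]; ring
  unfold annulusMap
  rw [hl]
  obtain ⟨m, rfl | rfl⟩ := k.eq_nat_or_neg
  · have := hper m z hz
    rw [show z + ((m : ℤ) : ℂ) = z + (m : ℂ) by push_cast; ring, this]
    exact_mod_cast E_add_intCast (G z) m
  · have hz' : z + ((-(m : ℤ) : ℤ) : ℂ) ∈ strip Δ := by simpa [strip] using hz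
    have h3 := hper m _ hz'
    have h4 : z + ((-(m : ℤ) : ℤ) : ℂ) + m = z := by push_cast; ring
    rw [h4] at h3
    rw [h3]
    exact_mod_cast (E_add_intCast (G (z + ((-(m : ℤ) : ℤ) : ℂ))) m).symm

end CircleDiffeo

end

noncomputable section

namespace CircleDiffeo

/-! Write S(x) for the sum of Dg^i(x) over i < q_n (`orbitTotal`). The lift of the curve is x -
iY/S(x) with Y a large constant; it lies below the real line because `E` sends the lower half-plane
outside the disk. Three facts make it quasi-invariant for large n. The iterates g^j, j ≤ q_n, are
almost affine on the disc of radius 2Y/S(x) about x. The product S(g^j x) Dg^j(x) is close to S(x),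
so the affine approximation maps the height of the curve at x almost to its height at g^j x. Finally
the closest return moves x by at most 3/S(x), that is by 3/Y relative to the height, and its
derivative is close to 1.

All three rest on |D log Dg^j| ≤ ε S for j ≤ q_n (`LogSmooth.abs_orbitSum_le`). By the order of the
orbits, which is that of the rotation, the first q_n images of a closest return interval have total
length at most 1. With |D log Dg| ≤ 1/9 this gives Denjoy's inequality 1/3 ≤ Dg^{q_n} ≤ 3
(`ApproxPair.orbitDeriv_bounds`), whence no single Dg^j carries a definite part of S. The function D
log Dg has zero mean. A zero-mean function bounded above by A modulo twisted coboundaries v -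
(v∘g)Dg is also bounded by 9A/10 modulo such coboundaries (`LogSmooth.coboundaryLE_step`), hence by
any ε > 0. Summed along an orbit, a coboundary leaves only two boundary terms, negligible against S.

Then 1/S is ε-Lipschitz, and since the displacement of the return map never vanishes, Dg^{q_n} must
be close to 1 (`ApproxPair.abs_orbitDeriv_sub_one_le`); telescoping gives the near invariance of S.
For complex points, the inverse of the ratio between the true and the linearized deviation changes
additively along the orbit, and its drift is controlled by D log Dg^j
(`LogSmooth.iterate_perturbation`). -/

/-! ### Convergents -/

/-- Numerators and denominators of the convergents of `ξ`, by the recursion of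
`Real.convergent`. -/
def convPair : ℝ → ℕ → ℤ × ℤ
  | ξ, 0 => (⌊ξ⌋, 1)
  | ξ, n + 1 => (⌊ξ⌋ * (convPair (Int.fract ξ)⁻¹ n).1 + (convPair (Int.fract ξ)⁻¹ n).2,
      (convPair (Int.fract ξ)⁻¹ n).1)

theorem convPair_succ (ξ : ℝ) (n : ℕ) : convPair ξ (n + 1) =
    (⌊ξ⌋ * (convPair (Int.fract ξ)⁻¹ n).1 + (convPair (Int.fract ξ)⁻¹ n).2,
      (convPair (Int.fract ξ)⁻¹ n).1) := rfl

theorem irrational_inv_fract {ξ : ℝ} (h : Irrational ξ) : Irrational (Int.fract ξ)⁻¹ := by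
  rw [irrational_inv_iff, Int.fract]
  exact h.sub_intCast _

theorem fract_pos_of_irrational {ξ : ℝ} (h : Irrational ξ) : 0 < Int.fract ξ :=
  Int.fract_pos.2 (h.ne_int _)

theorem one_lt_inv_fract {ξ : ℝ} (h : Irrational ξ) : 1 < (Int.fract ξ)⁻¹ :=
  (one_lt_inv₀ (fract_pos_of_irrational h)).2 (Int.fract_lt_one ξ)

theorem one_le_floor_inv_fract {ξ : ℝ} (h : Irrational ξ) : 1 ≤ ⌊(Int.fract ξ)⁻¹⌋ :=
  Int.le_floor.2 (by simpa using (one_lt_inv_fract h).le)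

theorem convPair_pos (n : ℕ) : ∀ {ξ : ℝ}, Irrational ξ → 1 ≤ ⌊ξ⌋ →
    1 ≤ (convPair ξ n).1 ∧ 1 ≤ (convPair ξ n).2 := by
  induction n with
  | zero => intro ξ _ h1; exact ⟨h1, le_rfl⟩
  | succ n ih =>
    intro ξ h h1
    obtain ⟨h2, h3⟩ := ih (irrational_inv_fract h) (one_le_floor_inv_fract h)
    refine ⟨?_, h2⟩
    simp only [convPair]
    nlinarith

theorem convPair_snd_pos {ξ : ℝ} (h : Irrational ξ) (n : ℕ) : 1 ≤ (convPair ξ n).2 := by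
  cases n with
  | zero => exact le_rfl
  | succ n => exact (convPair_pos n (irrational_inv_fract h) (one_le_floor_inv_fract h)).1

theorem convPair_det (n : ℕ) : ∀ ξ : ℝ,
    (convPair ξ (n + 1)).1 * (convPair ξ n).2 - (convPair ξ n).1 * (convPair ξ (n + 1)).2
      = (-1) ^ n := by
  induction n with
  | zero => intro ξ; simp [convPair]
  | succ n ih =>
    intro ξ
    have := ih (Int.fract ξ)⁻¹
    rw [convPair_succ ξ (n + 1), convPair_succ ξ n, pow_succ, ← this]
    ring

/-- Passing to the next complete quotient multiplies the error by a negative factor independent of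
n; alternation of signs and decrease of the errors follow by induction. -/
theorem convPair_error_succ {ξ : ℝ} (h : Irrational ξ) (n : ℕ) :
    (convPair ξ (n + 1)).2 * ξ - (convPair ξ (n + 1)).1 =
      -(Int.fract ξ) * ((convPair (Int.fract ξ)⁻¹ n).2 * (Int.fract ξ)⁻¹
        - (convPair (Int.fract ξ)⁻¹ n).1) := by
  have h0 := (fract_pos_of_irrational h).ne'
  simp only [convPair]
  push_cast
  have h1 : ξ = ⌊ξ⌋ + Int.fract ξ := (Int.floor_add_fract ξ).symm
  have h2 : Int.fract ξ * (Int.fract ξ)⁻¹ = 1 := mul_inv_cancel₀ h0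
  linear_combination ((convPair (Int.fract ξ)⁻¹ n).1 : ℝ) * h1 +
    ((convPair (Int.fract ξ)⁻¹ n).2 : ℝ) * h2

theorem convPair_error_pos (n : ℕ) : ∀ {ξ : ℝ}, Irrational ξ →
    0 < (-1) ^ n * ((convPair ξ n).2 * ξ - (convPair ξ n).1) := by
  induction n with
  | zero => intro ξ h; simpa [convPair] using fract_pos_of_irrational h
  | succ n ih =>
    intro ξ h
    have := mul_pos (fract_pos_of_irrational h) (ih (irrational_inv_fract h))
    rw [convPair_error_succ h, pow_succ]
    linarith

theorem convPair_error_lt (n : ℕ) : ∀ {ξ : ℝ}, Irrational ξ →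
    |(convPair ξ (n + 1)).2 * ξ - (convPair ξ (n + 1)).1| <
      |(convPair ξ n).2 * ξ - (convPair ξ n).1| := by
  induction n with
  | zero =>
    intro ξ h
    have h0 := fract_pos_of_irrational h
    rw [convPair_error_succ h, abs_mul, abs_neg, abs_of_pos h0]
    have h1 : ((convPair ξ 0).2 * ξ - (convPair ξ 0).1 : ℝ) = Int.fract ξ := by
      simp [convPair]
    have h2 : ((convPair (Int.fract ξ)⁻¹ 0).2 * (Int.fract ξ)⁻¹
        - (convPair (Int.fract ξ)⁻¹ 0).1 : ℝ) = Int.fract (Int.fract ξ)⁻¹ := by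
      simp [convPair]
    rw [h1, h2, abs_of_pos h0, abs_of_nonneg (Int.fract_nonneg _)]
    exact mul_lt_of_lt_one_right h0 (Int.fract_lt_one _)
  | succ n ih =>
    intro ξ h
    rw [convPair_error_succ h, convPair_error_succ h n, abs_mul, abs_mul]
    refine mul_lt_mul_of_pos_left (ih (irrational_inv_fract h)) ?_
    rw [abs_neg]
    exact abs_pos.2 (fract_pos_of_irrational h).ne'

theorem convPair_mono (n : ℕ) : ∀ {ξ : ℝ}, Irrational ξ → 1 ≤ ⌊ξ⌋ →
    (convPair ξ n).1 ≤ (convPair ξ (n + 1)).1 ∧ (convPair ξ n).2 ≤ (convPair ξ (n + 1)).2 := by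
  induction n with
  | zero =>
    intro ξ h h1
    have := one_le_floor_inv_fract h
    simp only [convPair]
    constructor <;> nlinarith
  | succ n ih =>
    intro ξ h h1
    obtain ⟨h2, h3⟩ := ih (irrational_inv_fract h) (one_le_floor_inv_fract h)
    rw [convPair, convPair]
    refine ⟨?_, h2⟩
    dsimp only
    gcongr

theorem convPair_two_mul (n : ℕ) : ∀ {ξ : ℝ}, Irrational ξ → 1 ≤ ⌊ξ⌋ →
    2 * (convPair ξ n).1 ≤ (convPair ξ (n + 2)).1 ∧
      2 * (convPair ξ n).2 ≤ (convPair ξ (n + 2)).2 := by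
  induction n with
  | zero =>
    intro ξ h h1
    have h2 := one_le_floor_inv_fract h
    have h3 := one_le_floor_inv_fract (irrational_inv_fract h)
    have h4 := mul_le_mul h2 h3 zero_le_one (by linarith)
    simp only [convPair]
    constructor <;> nlinarith
  | succ n ih =>
    intro ξ h h1
    obtain ⟨h2, h3⟩ := ih (irrational_inv_fract h) (one_le_floor_inv_fract h)
    rw [convPair, convPair]
    refine ⟨?_, h2⟩
    dsimp only
    nlinarith

theorem convPair_coprime (ξ : ℝ) (n : ℕ) : IsCoprime (convPair ξ n).1 (convPair ξ n).2 := by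
  have h := convPair_det n ξ
  have h2 : ((-1 : ℤ) ^ n) * (-1) ^ n = 1 := by rw [← mul_pow]; simp
  exact ⟨-(-1) ^ n * (convPair ξ (n + 1)).2, (-1) ^ n * (convPair ξ (n + 1)).1, by
    linear_combination (-1) ^ n * h + h2⟩

theorem convergent_eq_convPair (n : ℕ) : ∀ {ξ : ℝ}, Irrational ξ →
    Real.convergent ξ n = ((convPair ξ n).1 : ℚ) / (convPair ξ n).2 := by
  induction n with
  | zero => intro ξ h; simp [convPair]
  | succ n ih =>
    intro ξ h
    have h1 := (convPair_pos n (irrational_inv_fract h) (one_le_floor_inv_fract h)).1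
    have h2 : ((convPair (Int.fract ξ)⁻¹ n).1 : ℚ) ≠ 0 := by
      have : (convPair (Int.fract ξ)⁻¹ n).1 ≠ 0 := by omega
      exact_mod_cast this
    rw [Real.convergent_succ, ih (irrational_inv_fract h), convPair]
    push_cast
    rw [inv_div, add_div, mul_div_cancel_right₀ _ h2]

theorem convDen_eq {ξ : ℝ} (h : Irrational ξ) (n : ℕ) :
    (convDen ξ n : ℤ) = (convPair ξ n).2 := by
  have h1 := convPair_snd_pos h n
  rw [convDen, convergent_eq_convPair n h]
  exact Rat.den_div_eq_of_coprime (by omega) (Int.isCoprime_iff_nat_coprime.1 (convPair_coprime ξ n))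

theorem convDen_pos (ξ : ℝ) (n : ℕ) : 0 < convDen ξ n := Rat.den_pos _

theorem convDen_mono_succ {ξ : ℝ} (h : Irrational ξ) (n : ℕ) :
    convDen ξ n ≤ convDen ξ (n + 1) := by
  zify
  rw [convDen_eq h, convDen_eq h]
  cases n with
  | zero => exact convPair_snd_pos h 1
  | succ n => exact (convPair_mono n (irrational_inv_fract h) (one_le_floor_inv_fract h)).1

theorem two_mul_convDen_le {ξ : ℝ} (h : Irrational ξ) (n : ℕ) :
    2 * convDen ξ n ≤ convDen ξ (n + 2) := by
  zify
  rw [convDen_eq h, convDen_eq h]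
  cases n with
  | zero =>
    have h2 := one_le_floor_inv_fract h
    have h3 := one_le_floor_inv_fract (irrational_inv_fract h)
    have h4 := mul_le_mul h2 h3 zero_le_one (by linarith)
    simp only [convPair]
    nlinarith
  | succ n => exact (convPair_two_mul n (irrational_inv_fract h) (one_le_floor_inv_fract h)).1

/-- Two consecutive approximations of `α`: the denominator `N` with numerator `R`, and a signed
denominator `Q` with `Q α + P > 0`. -/
structure ApproxPair (α : ℝ) (N : ℕ) (R Q P : ℤ) : Prop where
  pos : 0 < N
  abs_den_le : |Q| ≤ N
  det : N * P + Q * R = 1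
  shift_pos : 0 < Q * α + P
  opposite : Q * (N * α - R) ≤ 0
  error_lt : |N * α - R| < Q * α + P

theorem exists_approxPair {α : ℝ} (h : Irrational α) {n : ℕ} (hn : 1 ≤ n) :
    ∃ Q P : ℤ, ApproxPair α (convDen α n) (convPair α n).1 Q P := by
  obtain ⟨m, rfl⟩ : ∃ m, n = m + 1 := ⟨n - 1, by omega⟩
  have hN : ((convDen α (m + 1) : ℕ) : ℝ) = ((convPair α (m + 1)).2 : ℝ) := by
    exact_mod_cast congrArg (Int.cast : ℤ → ℝ) (convDen_eq h (m + 1))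
  have hs : ((-1 : ℤ) ^ m) * (-1) ^ m = 1 := by rw [← mul_pow]; simp
  have hsR : ((-1 : ℝ) ^ m) * (-1) ^ m = 1 := by exact_mod_cast hs
  have h1 := convPair_error_pos m h
  have h2 := convPair_error_pos (m + 1) h
  have h3 := convPair_error_lt m h
  have habs : |((convPair α m).2 * α - (convPair α m).1 : ℝ)| =
      (-1) ^ m * ((convPair α m).2 * α - (convPair α m).1) := by
    rw [← abs_of_pos h1, abs_mul, abs_pow, abs_neg, abs_one, one_pow, one_mul]
  have hq := convPair_snd_pos h m
  have hqR : (0 : ℝ) < (convPair α m).2 := by exact_mod_cast (by omega : 0 < (convPair α m).2)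
  -- The sign makes Qα + P equal to |q_m α - p_m|, where m = n - 1.
  refine ⟨(-1) ^ m * (convPair α m).2, -(-1) ^ m * (convPair α m).1,
    convDen_pos _ _, ?_, ?_, ?_, ?_, ?_⟩
  · rw [abs_mul, abs_pow, abs_neg, abs_one, one_pow, one_mul, ← convDen_eq h, Nat.abs_cast]
    exact_mod_cast convDen_mono_succ h m
  · rw [convDen_eq h]
    linear_combination (-1) ^ m * convPair_det m α + hs
  · push_cast
    linarith
  · rw [hN]
    push_cast
    rw [pow_succ] at h2
    nlinarith
  · rw [hN]
    push_cast
    rw [habs] at h3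
    linarith

/-! ### Order structure of the orbits -/

/-- The `k`-th iterate, `k ∈ ℤ`, of an invertible lift. -/
def orbit (u : CircleDeg1Liftˣ) (k : ℤ) (x : ℝ) : ℝ := ((u ^ k : CircleDeg1Liftˣ) : CircleDeg1Lift) x

section Order

variable (u : CircleDeg1Liftˣ)

theorem orbit_add (k l : ℤ) (x : ℝ) : orbit u (k + l) x = orbit u k (orbit u l x) := by
  simp [orbit, zpow_add]

@[simp] theorem orbit_zero (x : ℝ) : orbit u 0 x = x := by simp [orbit]

@[simp] theorem orbit_one (x : ℝ) : orbit u 1 x = (u : CircleDeg1Lift) x := by simp [orbit]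

theorem orbit_natCast_succ (n : ℕ) (x : ℝ) :
    orbit u ((n + 1 : ℕ) : ℤ) x = (u : CircleDeg1Lift) (orbit u n x) := by
  rw [← orbit_one, ← orbit_add]; congr 1; push_cast; ring

theorem orbit_add_int (k : ℤ) (x : ℝ) (m : ℤ) : orbit u k (x + m) = orbit u k x + m :=
  CircleDeg1Lift.map_add_int _ _ _

theorem orbit_mono (k : ℤ) : Monotone (orbit u k) := CircleDeg1Lift.monotone _

theorem orbit_comm (k l : ℤ) (x : ℝ) : orbit u k (orbit u l x) = orbit u l (orbit u k x) := by
  rw [← orbit_add, ← orbit_add, add_comm]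

theorem orbit_orbit_neg (k : ℤ) (x : ℝ) : orbit u k (orbit u (-k) x) = x := by
  rw [← orbit_add]; simp

variable {u}

theorem lt_orbit_add {k p : ℤ}
    (h : 0 < k * (u : CircleDeg1Lift).translationNumber + p) (x : ℝ) : x < orbit u k x + p := by
  have h1 : ((-p : ℤ) : ℝ) <
      ((u ^ k : CircleDeg1Liftˣ) : CircleDeg1Lift).translationNumber := by
    rw [CircleDeg1Lift.translationNumber_zpow]; push_cast; linarith
  have := CircleDeg1Lift.lt_map_of_int_lt_translationNumber _ h1 x
  push_cast at this
  rw [orbit]; linarith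

theorem orbit_add_lt_orbit_add {k p l r : ℤ}
    (h : k * (u : CircleDeg1Lift).translationNumber + p <
      l * (u : CircleDeg1Lift).translationNumber + r) (x : ℝ) :
    orbit u k x + p < orbit u l x + r := by
  have := lt_orbit_add (u := u) (k := l - k) (p := r - p) (by push_cast; linarith) (orbit u k x)
  rw [← orbit_add, sub_add_cancel] at this
  push_cast at this
  linarith

/-- In the case of equality, irrationality forces k = l and p = r. -/
theorem orbit_add_le_orbit_add (hα : Irrational (u : CircleDeg1Lift).translationNumber)
    {k p l r : ℤ} (h : k * (u : CircleDeg1Lift).translationNumber + p ≤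
      l * (u : CircleDeg1Lift).translationNumber + r) (x : ℝ) :
    orbit u k x + p ≤ orbit u l x + r := by
  rcases h.lt_or_eq with h | h
  · exact (orbit_add_lt_orbit_add h x).le
  · by_cases hk : k = l
    · subst hk
      simpa using h.le
    · refine absurd ?_ (hα.ne_rat ((r - p : ℤ) / (k - l : ℤ)))
      have h0 : ((k : ℝ) - l) ≠ 0 := sub_ne_zero.2 (by exact_mod_cast hk)
      push_cast
      rw [eq_div_iff h0]
      linarith

end Order

/-! ### Cyclic order of the first `N` orbit points -/

theorem sum_range_emod (N : ℕ) (hN : 0 < N) (Q : ℤ) (f : ℤ → ℝ) :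
    ∑ i ∈ Finset.range N, f ((i + Q) % N) = ∑ i ∈ Finset.range N, f i := by
  have key : ∀ F : ℤ → ℝ, ∑ i ∈ Finset.range N, F i = ∑ i ∈ Finset.Ico (0 : ℤ) N, F i := by
    intro F
    refine Finset.sum_nbij' (fun i => (i : ℤ)) (fun i => i.toNat) ?_ ?_ ?_ ?_ ?_
    · intro i hi; simpa using hi
    · intro i hi; simp only [Finset.mem_Ico, Finset.mem_range] at *; omega
    · intro i _; simp
    · intro i hi; simp only [Finset.mem_Ico] at hi; simp [hi.1]
    · intro i _; rfl
  rw [key f, key fun i => f ((i + Q) % N)]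
  have hN' : (0 : ℤ) < N := by exact_mod_cast hN
  refine Finset.sum_nbij' (fun i => (i + Q) % N) (fun i => (i - Q) % N) ?_ ?_ ?_ ?_ ?_
  · intro i _
    exact Finset.mem_Ico.2 ⟨Int.emod_nonneg _ hN'.ne', Int.emod_lt_of_pos _ hN'⟩
  · intro i _
    exact Finset.mem_Ico.2 ⟨Int.emod_nonneg _ hN'.ne', Int.emod_lt_of_pos _ hN'⟩
  · intro i hi
    have hi := Finset.mem_Ico.1 hi
    simp [Int.emod_eq_of_lt hi.1 hi.2]
  · intro i hi
    have hi := Finset.mem_Ico.1 hi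
    simp [Int.emod_eq_of_lt hi.1 hi.2]
  · intro i _; rfl

theorem sum_range_ediv (N : ℕ) (hN : 0 < N) (Q : ℤ) :
    ∑ i ∈ Finset.range N, (((i + Q) / N : ℤ) : ℝ) = Q := by
  have hN' : (N : ℝ) ≠ 0 := by exact_mod_cast hN.ne'
  have h := sum_range_emod N hN Q fun i => (i : ℝ)
  have h2 : ∀ i ∈ Finset.range N, (((i + Q) % N : ℤ) : ℝ) =
      (i : ℤ) + Q - N * (((i + Q) / N : ℤ) : ℝ) := by
    intro i _
    have := Int.emod_add_mul_ediv (i + Q) N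
    rw [eq_sub_iff_add_eq]
    exact_mod_cast this
  rw [Finset.sum_congr rfl h2, Finset.sum_sub_distrib, Finset.sum_add_distrib,
    ← Finset.mul_sum, Finset.sum_const, Finset.card_range, nsmul_eq_mul] at h
  have h3 : (N : ℝ) * (Q - ∑ i ∈ Finset.range N, (((i + Q) / N : ℤ) : ℝ)) = 0 := by linarith
  rcases mul_eq_zero.1 h3 with h4 | h4
  · exact absurd h4 hN'
  · linarith

/-- The closest return map to the right: `u ^ Q` followed by the translation by `P`. -/
def shift (u : CircleDeg1Liftˣ) (Q P : ℤ) (x : ℝ) : ℝ := orbit u Q x + P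

section Returns

variable {u : CircleDeg1Liftˣ} {N : ℕ} {R Q P : ℤ}

theorem orbit_shift (i : ℤ) (x : ℝ) : orbit u i (shift u Q P x) = orbit u (i + Q) x + P := by
  rw [shift, orbit_add_int, ← orbit_add]

theorem orbit_shift_shift (i : ℤ) (x : ℝ) : orbit u i (shift u Q P (shift u Q P x)) =
    orbit u (i + 2 * Q) x + (2 * P : ℤ) := by
  rw [orbit_shift, orbit_shift]; push_cast; ring_nf

/-- The quotient is -1, 0 or 1, and when nonzero it has the sign of Q, opposite to that of Nα - R.
For the rotation, the bounded quantity is the distance from the i-th image of the shifted point to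
the combinatorial right neighbour of the i-th orbit point. -/
theorem ApproxPair.ediv_bounds {α : ℝ} (h : ApproxPair α N R Q P) {i : ℕ} (hi : i < N) :
    0 ≤ -(((i + Q) / N : ℤ) : ℝ) * (N * α - R) ∧
      -(((i + Q) / N : ℤ) : ℝ) * (N * α - R) ≤ Q * α + P := by
  have hN : (0 : ℤ) < N := by exact_mod_cast h.pos
  have h1 := abs_le.1 h.abs_den_le
  have hsp := h.shift_pos
  have hlt := abs_lt.1 h.error_lt
  have hop := h.opposite
  have hlo : -1 ≤ (i + Q) / (N : ℤ) := (Int.le_ediv_iff_mul_le hN).2 (by omega)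
  have hhi : (i + Q) / (N : ℤ) < 2 := (Int.ediv_lt_iff_lt_mul hN).2 (by omega)
  obtain hk | hk | hk : (i + Q) / (N : ℤ) = -1 ∨ (i + Q) / (N : ℤ) = 0 ∨ (i + Q) / (N : ℤ) = 1 := by
    omega
  · rw [hk]
    have hQ : Q < 0 := by
      by_contra hQ
      have := Int.ediv_nonneg (a := i + Q) (b := N) (by omega) hN.le
      omega
    have hQ' : (Q : ℝ) < 0 := by exact_mod_cast hQ
    push_cast
    constructor <;> nlinarith
  · rw [hk]
    push_cast
    constructor <;> linarith
  · rw [hk]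
    have hQ : 0 < Q := by
      by_contra hQ
      have := Int.ediv_lt_of_lt_mul hN (show i + Q < 1 * (N : ℤ) by omega)
      omega
    have hQ' : (0 : ℝ) < Q := by exact_mod_cast hQ
    push_cast
    constructor <;> nlinarith

variable (h : ApproxPair (u : CircleDeg1Lift).translationNumber N R Q P)
  (hα : Irrational (u : CircleDeg1Lift).translationNumber)

include h

theorem ApproxPair.lt_shift (x : ℝ) : x < shift u Q P x := lt_orbit_add h.shift_pos x

theorem ApproxPair.le_shift_shift (x : ℝ) : x ≤ shift u Q P (shift u Q P x) :=
  (h.lt_shift x).le.trans (h.lt_shift _).le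

/-- Since QR ≡ 1 mod N, replacing i by i + Q mod N moves one place to the right in the cyclic order
of the orbit points. This permutes the indices, and the integer translations add up to NP + QR = 1:
the gaps make exactly one turn. -/
theorem ApproxPair.sum_next (F : ℝ → ℝ) (l : ℝ) (hF : ∀ (t : ℝ) (m : ℤ), F (t + m) = F t + m * l)
    (x : ℝ) : ∑ i ∈ Finset.range N,
      (F (orbit u ((i + Q) % N) x + (P + (i + Q) / N * R : ℤ)) - F (orbit u i x)) = l := by
  have h1 : ∀ i ∈ Finset.range N,
      (F (orbit u ((i + Q) % N) x + (P + (i + Q) / N * R : ℤ)) - F (orbit u i x)) =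
      F (orbit u ((i + Q) % N) x) - F (orbit u i x) + (P * l + (((i + Q) / N : ℤ) : ℝ) * (R * l)) := by
    intro i _
    rw [hF]; push_cast; ring
  rw [Finset.sum_congr rfl h1, Finset.sum_add_distrib, Finset.sum_sub_distrib,
    sum_range_emod N h.pos Q fun i => F (orbit u i x), sub_self, zero_add,
    Finset.sum_add_distrib, Finset.sum_const, Finset.card_range, nsmul_eq_mul, ← Finset.sum_mul,
    sum_range_ediv N h.pos Q]
  have : ((N : ℝ) * P + Q * R) = 1 := by exact_mod_cast h.det
  linear_combination l * this

theorem ApproxPair.return_bounds (x : ℝ) :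
    orbit u N x - R ≤ shift u Q P x ∧ x ≤ shift u Q P (orbit u N x - R) := by
  have hlt := abs_lt.1 h.error_lt
  have h1 := orbit_add_lt_orbit_add (u := u) (k := N) (p := -R) (l := Q) (r := P)
    (by push_cast; linarith) x
  have h2 := orbit_add_lt_orbit_add (u := u) (k := 0) (p := 0) (l := Q + N) (r := P - R)
    (by push_cast; linarith) x
  push_cast at h1 h2
  rw [orbit_zero] at h2
  refine ⟨by rw [shift]; linarith, ?_⟩
  have h3 := orbit_add_int u Q (orbit u N x) (-R)
  rw [← orbit_add] at h3
  push_cast at h3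
  rw [shift, sub_eq_add_neg, h3]
  linarith

include hα

theorem ApproxPair.orbit_shift_le_next {i : ℕ} (hi : i < N) (x : ℝ) :
    orbit u i (shift u Q P x) ≤ orbit u ((i + Q) % N) x + (P + (i + Q) / N * R : ℤ) := by
  rw [orbit_shift]
  refine orbit_add_le_orbit_add hα ?_ x
  have h1 := (h.ediv_bounds hi).1
  have h2 : (((i + Q) % N : ℤ) : ℝ) = i + Q - N * (((i + Q) / N : ℤ) : ℝ) := by
    rw [eq_sub_iff_add_eq]; exact_mod_cast Int.emod_add_mul_ediv (i + Q) N
  rw [h2]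
  push_cast
  linarith

theorem ApproxPair.next_le_orbit_shift_shift {i : ℕ} (hi : i < N) (x : ℝ) :
    orbit u ((i + Q) % N) x + (P + (i + Q) / N * R : ℤ) ≤
      orbit u i (shift u Q P (shift u Q P x)) := by
  rw [orbit_shift_shift]
  refine orbit_add_le_orbit_add hα ?_ x
  have h1 := (h.ediv_bounds hi).2
  have h2 : (((i + Q) % N : ℤ) : ℝ) = i + Q - N * (((i + Q) / N : ℤ) : ℝ) := by
    rw [eq_sub_iff_add_eq]; exact_mod_cast Int.emod_add_mul_ediv (i + Q) N
  rw [h2]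
  push_cast
  linarith

/-- Each interval ends no later than the right neighbour of its left endpoint, and the gaps between
neighbours add up to 1. -/
theorem ApproxPair.sum_shift_le_one (x : ℝ) :
    ∑ i ∈ Finset.range N, (orbit u i (shift u Q P x) - orbit u i x) ≤ 1 := by
  rw [← h.sum_next (fun t => t) 1 (by intros; simp) x]
  refine Finset.sum_le_sum fun i hi => ?_
  have := h.orbit_shift_le_next hα (Finset.mem_range.1 hi) x
  linarith

theorem ApproxPair.sum_shift_shift_le_two (x : ℝ) :
    ∑ i ∈ Finset.range N, (orbit u i (shift u Q P (shift u Q P x)) - orbit u i x) ≤ 2 := by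
  have h1 := h.sum_shift_le_one hα x
  have h2 := h.sum_shift_le_one hα (shift u Q P x)
  have := add_le_add h1 h2
  rw [← Finset.sum_add_distrib] at this
  simp only [sub_add_sub_cancel'] at this
  linarith

theorem ApproxPair.le_sum_shift_shift {U : ℝ → ℝ} {l : ℝ} (hU : Monotone U)
    (hUl : ∀ (t : ℝ) (m : ℤ), U (t + m) = U t + m * l) (x : ℝ) :
    l ≤ ∑ i ∈ Finset.range N,
      (U (orbit u i (shift u Q P (shift u Q P x))) - U (orbit u i x)) := by
  rw [← h.sum_next U l hUl x]
  refine Finset.sum_le_sum fun i hi => ?_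
  have := hU (h.next_le_orbit_shift_shift hα (Finset.mem_range.1 hi) x)
  linarith

theorem ApproxPair.exists_cover (x y : ℝ) : ∃ (i : ℕ) (p : ℤ), i < N ∧
    orbit u i x + p ≤ y ∧ y ≤ orbit u i (shift u Q P (shift u Q P x)) + p := by
  obtain ⟨i, hi, hmax⟩ := Finset.exists_max_image (Finset.range N)
    (fun i : ℕ => orbit u i x + ⌊y - orbit u i x⌋) ⟨0, Finset.mem_range.2 h.pos⟩
  have hiN := Finset.mem_range.1 hi
  refine ⟨i, ⌊y - orbit u i x⌋, hiN, ?_, ?_⟩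
  · linarith [Int.floor_le (y - orbit u i x)]
  -- Otherwise the right neighbour of the chosen point is still below y and strictly larger, against
  -- maximality.
  · by_contra! hlt
    have h1 := h.orbit_shift_le_next hα hiN x
    have h2 := h.next_le_orbit_shift_shift hα hiN x
    have h3 : orbit u i x < orbit u i (shift u Q P x) := by
      rw [orbit_shift]
      have := orbit_add_lt_orbit_add (u := u) (k := i) (p := 0) (l := i + Q) (r := P)
        (by push_cast; linarith [h.shift_pos]) x
      simpa using this
    set p' : ℤ := P + (i + Q) / N * R + ⌊y - orbit u i x⌋ with hp'
    have hN' : (0 : ℤ) < N := by exact_mod_cast h.pos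
    obtain ⟨s, hs⟩ : ∃ s : ℕ, (s : ℤ) = (i + Q) % N :=
      ⟨((i + Q) % N).toNat, Int.toNat_of_nonneg (Int.emod_nonneg _ hN'.ne')⟩
    have hsN : s < N := by
      have := Int.emod_lt_of_pos (i + Q) hN'
      omega
    have h4 := hmax s (Finset.mem_range.2 hsN)
    rw [hs] at h4
    have h5 : p' ≤ ⌊y - orbit u ((i + Q) % N) x⌋ := by
      refine Int.le_floor.2 ?_
      rw [hp']; push_cast at h2 ⊢; linarith
    have h6 : (p' : ℝ) ≤ ⌊y - orbit u ((i + Q) % N) x⌋ := by exact_mod_cast h5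
    rw [hp'] at h6
    push_cast at h1 h6
    linarith

end Returns

/-! ### Distortion and Denjoy estimates -/

/-- `u` is a `C²` diffeomorphism with derivative `d` and `D log D u = φ`, where `|φ| ≤ 1/9`. -/
structure LogSmooth (u : CircleDeg1Liftˣ) (d φ : ℝ → ℝ) : Prop where
  hasDerivAt : ∀ x, HasDerivAt (u : CircleDeg1Lift) (d x) x
  pos : ∀ x, 0 < d x
  hasDerivAt_deriv : ∀ x, HasDerivAt d (φ x * d x) x
  bound : ∀ x, |φ x| ≤ 1 / 9
  cont : Continuous φ

/-- The derivative of `u ^ i`, by the chain rule. -/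
def orbitDeriv (u : CircleDeg1Liftˣ) (d : ℝ → ℝ) (i : ℕ) (x : ℝ) : ℝ :=
  ∏ k ∈ Finset.range i, d (orbit u k x)

/-- The sum of the derivatives of the first `N` iterates. -/
def orbitTotal (u : CircleDeg1Liftˣ) (d : ℝ → ℝ) (N : ℕ) (x : ℝ) : ℝ :=
  ∑ i ∈ Finset.range N, orbitDeriv u d i x

/-- The sum of `w` along an orbit, weighted by the derivatives of the iterates. -/
def orbitSum (u : CircleDeg1Liftˣ) (d : ℝ → ℝ) (j : ℕ) (w : ℝ → ℝ) (x : ℝ) : ℝ :=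
  ∑ i ∈ Finset.range j, w (orbit u i x) * orbitDeriv u d i x

variable {u : CircleDeg1Liftˣ} {d φ : ℝ → ℝ}

@[simp] theorem orbitDeriv_zero (x : ℝ) : orbitDeriv u d 0 x = 1 := by simp [orbitDeriv]

theorem orbitDeriv_succ (i : ℕ) (x : ℝ) :
    orbitDeriv u d (i + 1) x = orbitDeriv u d i x * d (orbit u i x) := by
  simp [orbitDeriv, Finset.prod_range_succ]

theorem orbitDeriv_add (i j : ℕ) (x : ℝ) :
    orbitDeriv u d (i + j) x = orbitDeriv u d i (orbit u j x) * orbitDeriv u d j x := by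
  induction i with
  | zero => simp
  | succ i ih =>
    rw [Nat.add_right_comm, orbitDeriv_succ, ih, orbitDeriv_succ, ← orbit_add]
    push_cast
    ring

theorem periodic_int_of_one {w : ℝ → ℝ} (hw : Function.Periodic w 1) (x : ℝ) (m : ℤ) :
    w (x + m) = w x := by
  have := hw.int_mul m x
  simpa using this

namespace LogSmooth

variable (hs : LogSmooth u d φ)
include hs

theorem periodic_deriv : Function.Periodic d 1 := by
  intro x
  have h1 : HasDerivAt (fun y => (u : CircleDeg1Lift) (y + 1)) (d (x + 1)) x :=
    (hs.hasDerivAt (x + 1)).comp_add_const x 1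
  have h2 : HasDerivAt (fun y => (u : CircleDeg1Lift) (y + 1)) (d x) x := by
    simpa only [CircleDeg1Lift.map_add_one] using (hs.hasDerivAt x).add_const 1
  exact h1.unique h2

theorem periodic_logDeriv : Function.Periodic φ 1 := by
  intro x
  have h1 : HasDerivAt (fun y => d (y + 1)) (φ (x + 1) * d (x + 1)) x :=
    (hs.hasDerivAt_deriv (x + 1)).comp_add_const x 1
  have h2 : HasDerivAt (fun y => d (y + 1)) (φ x * d x) x := by
    simpa only [hs.periodic_deriv _] using hs.hasDerivAt_deriv x
  have h3 := h1.unique h2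
  rw [hs.periodic_deriv x] at h3
  exact mul_right_cancel₀ (hs.pos x).ne' h3

theorem continuous_deriv : Continuous d :=
  continuous_iff_continuousAt.2 fun x => (hs.hasDerivAt_deriv x).continuousAt

theorem orbitDeriv_pos (i : ℕ) (x : ℝ) : 0 < orbitDeriv u d i x :=
  Finset.prod_pos fun _ _ => hs.pos _

theorem orbitDeriv_add_int (i : ℕ) (x : ℝ) (m : ℤ) :
    orbitDeriv u d i (x + m) = orbitDeriv u d i x := by
  simp only [orbitDeriv, orbit_add_int, periodic_int_of_one hs.periodic_deriv]

theorem hasDerivAt_orbit (i : ℕ) (x : ℝ) : HasDerivAt (orbit u i) (orbitDeriv u d i x) x := by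
  induction i with
  | zero =>
    have : orbit u ((0 : ℕ) : ℤ) = id := funext fun y => by simp
    rw [this, orbitDeriv_zero]
    exact hasDerivAt_id x
  | succ i ih =>
    have : orbit u ((i + 1 : ℕ) : ℤ) = fun y => (u : CircleDeg1Lift) (orbit u i y) :=
      funext fun y => orbit_natCast_succ u i y
    rw [this, orbitDeriv_succ, mul_comm]
    exact (hs.hasDerivAt _).comp x ih

theorem continuous_orbit (i : ℕ) : Continuous (orbit u i) :=
  continuous_iff_continuousAt.2 fun x => (hs.hasDerivAt_orbit i x).continuousAt

theorem continuous_orbitDeriv (i : ℕ) : Continuous (orbitDeriv u d i) := by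
  unfold orbitDeriv
  exact continuous_finsetProd _ fun k _ => hs.continuous_deriv.comp (hs.continuous_orbit k)

theorem orbitTotal_pos {N : ℕ} (hN : 0 < N) (x : ℝ) : 0 < orbitTotal u d N x :=
  Finset.sum_pos (fun _ _ => hs.orbitDeriv_pos _ _) ⟨0, Finset.mem_range.2 hN⟩

theorem orbitTotal_mono {j N : ℕ} (hj : j ≤ N) (x : ℝ) :
    orbitTotal u d j x ≤ orbitTotal u d N x :=
  Finset.sum_le_sum_of_subset_of_nonneg (Finset.range_mono hj)
    fun _ _ _ => (hs.orbitDeriv_pos _ _).le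

theorem orbitTotal_add_int (N : ℕ) (x : ℝ) (m : ℤ) :
    orbitTotal u d N (x + m) = orbitTotal u d N x := by
  simp only [orbitTotal, hs.orbitDeriv_add_int]

theorem continuous_orbitTotal (N : ℕ) : Continuous (orbitTotal u d N) :=
  continuous_finsetSum _ fun i _ => hs.continuous_orbitDeriv i

theorem hasDerivAt_log_deriv (x : ℝ) : HasDerivAt (fun y => Real.log (d y)) (φ x) x := by
  have := (hs.hasDerivAt_deriv x).log (hs.pos x).ne'
  rwa [mul_div_cancel_right₀ _ (hs.pos x).ne'] at this

theorem abs_log_deriv_sub_le (x y : ℝ) : |Real.log (d y) - Real.log (d x)| ≤ 1 / 9 * |y - x| :=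
  Convex.norm_image_sub_le_of_norm_hasDerivWithin_le
    (fun z _ => (hs.hasDerivAt_log_deriv z).hasDerivWithinAt)
    (fun z _ => hs.bound z) convex_univ (Set.mem_univ x) (Set.mem_univ y)

theorem abs_log_orbitDeriv_sub_le (j : ℕ) (x y : ℝ) :
    |Real.log (orbitDeriv u d j y) - Real.log (orbitDeriv u d j x)| ≤
      1 / 9 * ∑ i ∈ Finset.range j, |orbit u i y - orbit u i x| := by
  unfold orbitDeriv
  rw [Real.log_prod fun i _ => (hs.pos _).ne', Real.log_prod fun i _ => (hs.pos _).ne',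
    ← Finset.sum_sub_distrib, Finset.mul_sum]
  exact (Finset.abs_sum_le_sum_abs _ _).trans
    (Finset.sum_le_sum fun i _ => hs.abs_log_deriv_sub_le _ _)

end LogSmooth

section Denjoy

variable {N : ℕ} {R Q P : ℤ} (hs : LogSmooth u d φ)
  (h : ApproxPair (u : CircleDeg1Lift).translationNumber N R Q P)
  (hα : Irrational (u : CircleDeg1Lift).translationNumber)

include hs h hα

/-- Denjoy's distortion argument: the images of the double return interval have total length at most
2, and log Dg is 1/9-Lipschitz. -/
theorem ApproxPair.abs_log_orbitDeriv_sub_le {j : ℕ} (hj : j ≤ N) {x y z : ℝ}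
    (hxy : x ≤ y) (hyx : y ≤ shift u Q P (shift u Q P x))
    (hxz : x ≤ z) (hzx : z ≤ shift u Q P (shift u Q P x)) :
    |Real.log (orbitDeriv u d j y) - Real.log (orbitDeriv u d j z)| ≤ 2 / 9 := by
  refine (hs.abs_log_orbitDeriv_sub_le j z y).trans ?_
  have h1 : ∑ i ∈ Finset.range j, |orbit u i y - orbit u i z| ≤ 2 := by
    refine le_trans ?_ (h.sum_shift_shift_le_two hα x)
    refine (Finset.sum_le_sum_of_subset_of_nonneg (Finset.range_mono hj)
      fun _ _ _ => abs_nonneg _).trans (Finset.sum_le_sum fun i _ => ?_)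
    have a1 := orbit_mono u i hxy
    have a2 := orbit_mono u i hyx
    have a3 := orbit_mono u i hxz
    have a4 := orbit_mono u i hzx
    exact abs_le.2 ⟨by linarith, by linarith⟩
  linarith

theorem ApproxPair.orbitDeriv_le {j : ℕ} (hj : j ≤ N) {x y z : ℝ}
    (hxy : x ≤ y) (hyx : y ≤ shift u Q P (shift u Q P x))
    (hxz : x ≤ z) (hzx : z ≤ shift u Q P (shift u Q P x)) :
    orbitDeriv u d j y ≤ 3 / 2 * orbitDeriv u d j z := by
  have h1 := (le_abs_self _).trans (h.abs_log_orbitDeriv_sub_le hs hα hj hxy hyx hxz hzx)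
  have hy := hs.orbitDeriv_pos j y
  have hz := hs.orbitDeriv_pos j z
  -- This gives log(3/2) ≥ 1/3, which exceeds the distortion 2/9.
  have h2 := Real.one_sub_inv_le_log_of_pos (show (0 : ℝ) < 3 / 2 by norm_num)
  rw [← Real.log_le_log_iff hy (by positivity), Real.log_mul (by norm_num) hz.ne']
  norm_num at h2
  linarith

/-- By the mean value theorem and bounded distortion, length times Dg^i(y) is at most 3/2 of the
length of the i-th image; these lengths add up to at most 2. -/
theorem ApproxPair.shift_sub_mul_orbitTotal_le {x y : ℝ} (hxy : x ≤ y)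
    (hyx : y ≤ shift u Q P (shift u Q P x)) :
    (shift u Q P (shift u Q P x) - x) * orbitTotal u d N y ≤ 3 := by
  have hlt : x < shift u Q P (shift u Q P x) := (h.lt_shift x).trans (h.lt_shift _)
  have h1 : ∀ i ∈ Finset.range N, (shift u Q P (shift u Q P x) - x) * orbitDeriv u d i y ≤
      3 / 2 * (orbit u i (shift u Q P (shift u Q P x)) - orbit u i x) := by
    intro i hi
    obtain ⟨c, hc, hc'⟩ := exists_hasDerivAt_eq_slope (orbit u i) (orbitDeriv u d i) hlt
      (hs.continuous_orbit i).continuousOn fun t _ => hs.hasDerivAt_orbit i t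
    have h2 := h.orbitDeriv_le hs hα (Finset.mem_range.1 hi).le hxy hyx hc.1.le hc.2.le
    have h3 : 0 < shift u Q P (shift u Q P x) - x := sub_pos.2 hlt
    rw [eq_div_iff h3.ne'] at hc'
    nlinarith
  rw [orbitTotal, Finset.mul_sum]
  refine (Finset.sum_le_sum h1).trans ?_
  rw [← Finset.mul_sum]
  have := h.sum_shift_shift_le_two hα x
  linarith

theorem ApproxPair.abs_return_mul_orbitTotal_le (x : ℝ) :
    |orbit u N x - R - x| * orbitTotal u d N x ≤ 3 := by
  have hpos := (hs.orbitTotal_pos h.pos x).le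
  obtain ⟨h1, h2⟩ := h.return_bounds x
  rcases le_total x (orbit u N x - R) with h3 | h3
  · refine le_trans ?_ (h.shift_sub_mul_orbitTotal_le hs hα le_rfl (h.le_shift_shift x))
    rw [abs_of_nonneg (by linarith)]
    gcongr
    linarith [h.lt_shift (shift u Q P x)]
  · have h4 := h.lt_shift (shift u Q P (orbit u N x - R))
    refine le_trans ?_ (h.shift_sub_mul_orbitTotal_le hs hα h3 (h2.trans h4.le))
    rw [abs_of_nonpos (by linarith)]
    gcongr
    linarith

theorem ApproxPair.orbitDeriv_near_return {j : ℕ} (hj : j ≤ N) (x : ℝ) :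
    orbitDeriv u d j (orbit u N x) ≤ 3 / 2 * orbitDeriv u d j x ∧
      orbitDeriv u d j x ≤ 3 / 2 * orbitDeriv u d j (orbit u N x) := by
  obtain ⟨h1, h2⟩ := h.return_bounds x
  have h5 : orbitDeriv u d j (orbit u N x) = orbitDeriv u d j (orbit u N x - R) := by
    have := hs.orbitDeriv_add_int j (orbit u N x - R) R
    rwa [sub_add_cancel] at this
  rw [h5]
  rcases le_total x (orbit u N x - R) with h3 | h3
  · have h4 := h1.trans (h.lt_shift (shift u Q P x)).le
    have h6 := h.le_shift_shift x
    exact ⟨h.orbitDeriv_le hs hα hj h3 h4 le_rfl h6, h.orbitDeriv_le hs hα hj le_rfl h6 h3 h4⟩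
  · have h4 := h2.trans (h.lt_shift (shift u Q P (orbit u N x - R))).le
    have h6 := h.le_shift_shift (orbit u N x - R)
    exact ⟨h.orbitDeriv_le hs hα hj le_rfl h6 h3 h4, h.orbitDeriv_le hs hα hj h3 h4 le_rfl h6⟩

/-- Denjoy's inequality. Dg^N equals 1 at some z, since g^N gains 1 over a period. The chain rule
gives Dg^N(g^i z) = Dg^i(g^N z)/Dg^i(z), which lies in [2/3, 3/2] because z and its return are
close. Double return intervals based at the points g^i z cover the line, so y costs one more factor
3/2. -/
theorem ApproxPair.orbitDeriv_bounds (y : ℝ) :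
    orbitDeriv u d N y ≤ 3 ∧ 1 ≤ 3 * orbitDeriv u d N y := by
  obtain ⟨z, -, hz⟩ := exists_hasDerivAt_eq_slope (orbit u N) (orbitDeriv u d N) zero_lt_one
    (hs.continuous_orbit N).continuousOn fun t _ => hs.hasDerivAt_orbit N t
  have hz1 : orbitDeriv u d N z = 1 := by
    have := orbit_add_int u N 0 1
    push_cast at this
    rw [zero_add] at this
    rw [hz, this]; ring
  obtain ⟨i, p, hi, h1, h2⟩ := h.exists_cover hα z y
  have h3 : orbitDeriv u d N (orbit u i z) * orbitDeriv u d i z =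
      orbitDeriv u d i (orbit u N z) := by
    rw [← orbitDeriv_add, add_comm, orbitDeriv_add, hz1, mul_one]
  obtain ⟨h4, h5⟩ := h.orbitDeriv_near_return hs hα hi.le z
  have hpos := hs.orbitDeriv_pos i z
  have h6 : orbitDeriv u d N (orbit u i z) ≤ 3 / 2 := by
    refine le_of_mul_le_mul_right ?_ hpos
    rw [h3]; exact h4
  have h7 : 2 / 3 ≤ orbitDeriv u d N (orbit u i z) := by
    refine le_of_mul_le_mul_right ?_ hpos
    rw [h3]; linarith
  have h8 : orbit u i (shift u Q P (shift u Q P z)) + p =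
      shift u Q P (shift u Q P (orbit u i z + p)) := by
    have e1 : ∀ t, shift u Q P (orbit u i t + p) = orbit u i (shift u Q P t) + p := by
      intro t
      rw [shift, shift, orbit_add_int, orbit_add_int, orbit_comm]; ring
    rw [e1, e1]
  rw [h8] at h2
  have h9 := h.le_shift_shift (orbit u i z + p)
  have h10 := h.orbitDeriv_le hs hα le_rfl h1 h2 le_rfl h9
  have h11 := h.orbitDeriv_le hs hα le_rfl le_rfl h9 h1 h2
  rw [hs.orbitDeriv_add_int] at h10 h11
  constructor <;> linarith

end Denjoy

/-! ### No single iterate dominates the total derivative -/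

theorem strictMono_convDen_odd {ξ : ℝ} (h : Irrational ξ) :
    StrictMono fun k : ℕ => convDen ξ (2 * k + 1) := by
  refine strictMono_nat_of_lt_succ fun k => ?_
  have h1 := two_mul_convDen_le h (2 * k + 1)
  have h2 := convDen_pos ξ (2 * k + 1)
  have : 2 * (k + 1) + 1 = 2 * k + 1 + 2 := by ring
  rw [this]
  omega

/-- Moving the index j by a convergent denominator changes Dg^j by a factor at most 3, and K
distinct indices below q_n can be reached in this way. -/
theorem LogSmooth.mul_orbitDeriv_le (hs : LogSmooth u d φ)
    (hα : Irrational (u : CircleDeg1Lift).translationNumber) {n K : ℕ} (hK : 2 * K + 1 ≤ n)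
    {j : ℕ} (hj : j ≤ convDen (u : CircleDeg1Lift).translationNumber n) (x : ℝ) :
    K * orbitDeriv u d j x ≤
      9 * orbitTotal u d (convDen (u : CircleDeg1Lift).translationNumber n) x := by
  set α := (u : CircleDeg1Lift).translationNumber with hαdef
  have hden : ∀ m, 1 ≤ m → ∀ y, orbitDeriv u d (convDen α m) y ≤ 3 ∧
      1 ≤ 3 * orbitDeriv u d (convDen α m) y := by
    intro m hm y
    obtain ⟨Q, P, h⟩ := exists_approxPair hα hm
    exact h.orbitDeriv_bounds hs hα y
  have hmono : Monotone (convDen α) := monotone_nat_of_le_succ (convDen_mono_succ hα)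
  have key : ∀ j < convDen α n, K * orbitDeriv u d j x ≤ 3 * orbitTotal u d (convDen α n) x := by
    intro j hj
    -- Subtract q_{2k+1} if possible. Otherwise j + q_{2k+1} < 2 q_{2k+1} ≤ q_{2k+3} ≤ q_n, which is
    -- why only odd indices are used.
    set f : ℕ → ℕ := fun k => if convDen α (2 * k + 1) ≤ j then j - convDen α (2 * k + 1)
      else j + convDen α (2 * k + 1) with hf
    have hinj : Set.InjOn f (Finset.range K : Set ℕ) := by
      intro a _ b _ hab
      refine (strictMono_convDen_odd hα).injective ?_
      have ha := convDen_pos α (2 * a + 1)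
      have hb := convDen_pos α (2 * b + 1)
      simp only [hf] at hab ⊢
      split_ifs at hab <;> omega
    have hle : ∀ k ∈ Finset.range K, f k ∈ Finset.range (convDen α n) ∧
        orbitDeriv u d j x ≤ 3 * orbitDeriv u d (f k) x := by
      intro k hk
      have hk := Finset.mem_range.1 hk
      have h2 : 2 * convDen α (2 * k + 1) ≤ convDen α n :=
        (two_mul_convDen_le hα _).trans (hmono (by omega))
      have hd := hden (2 * k + 1) (by omega)
      simp only [hf, Finset.mem_range]
      split_ifs with hc
      · refine ⟨by omega, ?_⟩
        have h3 := orbitDeriv_add (u := u) (d := d) (convDen α (2 * k + 1))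
          (j - convDen α (2 * k + 1)) x
        rw [Nat.add_sub_cancel' hc] at h3
        rw [h3]
        exact mul_le_mul_of_nonneg_right (hd _).1 (hs.orbitDeriv_pos _ _).le
      · refine ⟨by omega, ?_⟩
        have h3 := orbitDeriv_add (u := u) (d := d) (convDen α (2 * k + 1)) j x
        rw [add_comm j, h3]
        have := mul_le_mul_of_nonneg_right (hd (orbit u j x)).2 (hs.orbitDeriv_pos j x).le
        linarith
    calc K * orbitDeriv u d j x = ∑ _k ∈ Finset.range K, orbitDeriv u d j x := by simp
      _ ≤ ∑ k ∈ Finset.range K, 3 * orbitDeriv u d (f k) x :=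
        Finset.sum_le_sum fun k hk => (hle k hk).2
      _ = 3 * ∑ i ∈ (Finset.range K).image f, orbitDeriv u d i x := by
        rw [Finset.sum_image hinj, Finset.mul_sum]
      _ ≤ 3 * orbitTotal u d (convDen α n) x := by
        refine mul_le_mul_of_nonneg_left ?_ (by norm_num)
        refine Finset.sum_le_sum_of_subset_of_nonneg ?_ fun _ _ _ => (hs.orbitDeriv_pos _ _).le
        intro i hi
        obtain ⟨k, hk, rfl⟩ := Finset.mem_image.1 hi
        exact (hle k hk).1
  rcases hj.lt_or_eq with hj | rfl
  · have h1 := key j hj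
    have := hs.orbitTotal_pos (convDen_pos α n) x
    linarith
  -- The index q_n is outside the sum; Dg^{q_n} ≤ 3 = 3 Dg^0 reduces it to j = 0.
  · have h1 := key 0 (convDen_pos α n)
    rw [orbitDeriv_zero] at h1
    have h2 := (hden n (by omega) x).1
    have : (0 : ℝ) ≤ K := Nat.cast_nonneg K
    nlinarith

/-- No single iterate of order at most `q_n` carries a definite part of the total derivative. -/
theorem LogSmooth.exists_orbitDeriv_le (hs : LogSmooth u d φ)
    (hα : Irrational (u : CircleDeg1Lift).translationNumber) {ε : ℝ} (hε : 0 < ε) :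
    ∃ n₀ : ℕ, ∀ n ≥ n₀, ∀ x, ∀ j ≤ convDen (u : CircleDeg1Lift).translationNumber n,
      orbitDeriv u d j x ≤
        ε * orbitTotal u d (convDen (u : CircleDeg1Lift).translationNumber n) x := by
  obtain ⟨K, hK⟩ := exists_nat_gt (9 / ε)
  refine ⟨2 * K + 1, fun n hn x j hj => ?_⟩
  have h1 := hs.mul_orbitDeriv_le hα hn hj x
  have h2 : 9 < K * ε := (div_lt_iff₀ hε).1 hK
  have h3 := hs.orbitDeriv_pos j x
  have h4 := hs.orbitTotal_pos (convDen_pos (u : CircleDeg1Lift).translationNumber n) x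
  have hK0 : (0 : ℝ) < K := lt_trans (by positivity) hK
  refine le_of_mul_le_mul_left ?_ hK0
  nlinarith

/-! ### Vanishing of the averaged nonlinearity -/

theorem exists_modulus_of_periodic {w : ℝ → ℝ} (hw : Continuous w) (hp : Function.Periodic w 1)
    {ε : ℝ} (hε : 0 < ε) : ∃ δ > 0, ∀ x y, |x - y| ≤ δ → |w x - w y| ≤ ε := by
  have huc := isCompact_Icc.uniformContinuousOn_of_continuous
    (hw.continuousOn (s := Set.Icc (-1 : ℝ) 2))
  obtain ⟨δ, hδ, h⟩ := Metric.uniformContinuousOn_iff_le.1 huc ε hε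
  refine ⟨min δ 1, by positivity, fun x y hxy => ?_⟩
  have h1 := Int.floor_le x
  have h2 := Int.lt_floor_add_one x
  have h3 := hxy.trans (min_le_left _ _)
  have h4 := abs_le.1 (hxy.trans (min_le_right _ _))
  have e1 := periodic_int_of_one hp x (-⌊x⌋)
  have e2 := periodic_int_of_one hp y (-⌊x⌋)
  rw [← e1, ← e2]
  push_cast
  have := h (x + -⌊x⌋) ⟨by linarith, by linarith⟩ (y + -⌊x⌋) ⟨by linarith, by linarith⟩
    (by rw [Real.dist_eq, add_sub_add_right_eq_sub]; exact h3)
  rwa [Real.dist_eq] at this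

theorem exists_bound_of_periodic {w : ℝ → ℝ} (hw : Continuous w) (hp : Function.Periodic w 1) :
    ∃ B > 0, ∀ x, |w x| ≤ B := by
  obtain ⟨B, hB, h⟩ := (hp.isBounded_of_continuous one_ne_zero hw).exists_pos_norm_le
  exact ⟨B, hB, fun x => h _ ⟨x, rfl⟩⟩

theorem add_int_of_add_one {U : ℝ → ℝ} {l : ℝ} (hU : ∀ t, U (t + 1) = U t + l) (t : ℝ) (m : ℤ) :
    U (t + m) = U t + m * l := by
  have hp : Function.Periodic (fun t => U t - t * l) 1 := fun t => by
    simp only [hU]; ring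
  have : U (t + m) - (t + m) * l = U t - t * l := periodic_int_of_one hp t m
  linarith

theorem exists_antideriv_of_periodic {v : ℝ → ℝ} (hv : Continuous v)
    (hp : Function.Periodic v 1) :
    ∃ (V : ℝ → ℝ) (c : ℝ), (∀ t, HasDerivAt V (v t) t) ∧ ∀ t, V (t + 1) = V t + c := by
  refine ⟨fun t => ∫ s in (0 : ℝ)..t, v s, ∫ s in (0 : ℝ)..1, v s,
    fun t => intervalIntegral.integral_hasDerivAt_right (hv.intervalIntegrable _ _)
      (hv.stronglyMeasurableAtFilter _ _) hv.continuousAt, fun t => ?_⟩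
  have h1 := hp.intervalIntegral_add_eq t 0
  rw [zero_add] at h1
  rw [← h1]
  exact (intervalIntegral.integral_add_adjacent_intervals (hv.intervalIntegrable _ _)
    (hv.intervalIntegrable _ _)).symm

/-! ### Weighted orbit sums and twisted coboundaries -/

theorem orbitSum_one (N : ℕ) (x : ℝ) : orbitSum u d N (fun _ => 1) x = orbitTotal u d N x := by
  simp [orbitSum, orbitTotal]

theorem orbitSum_succ (j : ℕ) (w : ℝ → ℝ) (x : ℝ) : orbitSum u d (j + 1) w x =
    orbitSum u d j w x + w (orbit u j x) * orbitDeriv u d j x := Finset.sum_range_succ _ _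

theorem orbitDeriv_map (j : ℕ) (x : ℝ) :
    orbitDeriv u d j ((u : CircleDeg1Lift) x) * d x = orbitDeriv u d (j + 1) x := by
  have := orbitDeriv_add (u := u) (d := d) j 1 x
  rw [this]
  simp [orbitDeriv]

theorem orbit_map (j : ℕ) (x : ℝ) :
    orbit u j ((u : CircleDeg1Lift) x) = orbit u (j + 1 : ℕ) x := by
  rw [← orbit_one, ← orbit_add]; push_cast; rfl

theorem orbitSum_map (j : ℕ) (w : ℝ → ℝ) (x : ℝ) :
    orbitSum u d j w ((u : CircleDeg1Lift) x) * d x =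
      orbitSum u d j w x - w x + w (orbit u j x) * orbitDeriv u d j x := by
  have h1 : orbitSum u d j w ((u : CircleDeg1Lift) x) * d x =
      ∑ i ∈ Finset.range j, w (orbit u (i + 1 : ℕ) x) * orbitDeriv u d (i + 1) x := by
    rw [orbitSum, Finset.sum_mul]
    refine Finset.sum_congr rfl fun i _ => ?_
    rw [← orbit_map, ← orbitDeriv_map]; ring
  have h2 := Finset.sum_range_succ' (fun i : ℕ => w (orbit u i x) * orbitDeriv u d i x) j
  rw [Finset.sum_range_succ] at h2
  simp only [Nat.cast_zero, orbit_zero, orbitDeriv_zero, mul_one] at h2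
  rw [h1, orbitSum]
  linarith

theorem orbitSum_coboundary (j : ℕ) (v : ℝ → ℝ) (x : ℝ) :
    orbitSum u d j (fun y => v y - v ((u : CircleDeg1Lift) y) * d y) x =
      v x - v (orbit u j x) * orbitDeriv u d j x := by
  induction j with
  | zero => simp [orbitSum]
  | succ j ih =>
    rw [orbitSum_succ, ih, orbit_natCast_succ, orbitDeriv_succ]; ring

/-- The twisted-cohomological partner of the Birkhoff average of `w`. -/
def orbitDoubleSum (u : CircleDeg1Liftˣ) (d : ℝ → ℝ) (N : ℕ) (w : ℝ → ℝ) (x : ℝ) : ℝ :=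
  ∑ j ∈ Finset.range N, orbitSum u d j w x

/-- Each term w∘g^i · Dg^i is twisted-cohomologous to w, so w may be replaced by its weighted
average; with w = 1, the total derivative may be replaced by N. -/
theorem orbitDoubleSum_sub (N : ℕ) (w : ℝ → ℝ) (x : ℝ) :
    orbitDoubleSum u d N w x - orbitDoubleSum u d N w ((u : CircleDeg1Lift) x) * d x =
      N * w x - orbitSum u d N w x := by
  rw [orbitDoubleSum, orbitDoubleSum, Finset.sum_mul, ← Finset.sum_sub_distrib]
  simp only [orbitSum_map]
  rw [orbitSum, ← nsmul_eq_mul, ← Finset.card_range N, ← Finset.sum_const, Finset.card_range,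
    ← Finset.sum_sub_distrib]
  exact Finset.sum_congr rfl fun i _ => by ring

namespace LogSmooth

variable (hs : LogSmooth u d φ)
include hs

theorem continuous_orbitSum {w : ℝ → ℝ} (hw : Continuous w) (j : ℕ) :
    Continuous (orbitSum u d j w) :=
  continuous_finsetSum _ fun i _ =>
    (hw.comp (hs.continuous_orbit i)).mul (hs.continuous_orbitDeriv i)

theorem periodic_orbitSum {w : ℝ → ℝ} (hw : Function.Periodic w 1) (j : ℕ) :
    Function.Periodic (orbitSum u d j w) 1 := by
  intro x
  refine Finset.sum_congr rfl fun i _ => ?_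
  have h1 := orbit_add_int u i x 1
  have h2 := hs.orbitDeriv_add_int i x 1
  push_cast at h1 h2
  rw [h1, h2, hw]

theorem continuous_orbitDoubleSum {w : ℝ → ℝ} (hw : Continuous w) (N : ℕ) :
    Continuous (orbitDoubleSum u d N w) :=
  continuous_finsetSum _ fun i _ => hs.continuous_orbitSum hw i

theorem periodic_orbitDoubleSum {w : ℝ → ℝ} (hw : Function.Periodic w 1) (N : ℕ) :
    Function.Periodic (orbitDoubleSum u d N w) 1 := fun x =>
  Finset.sum_congr rfl fun i _ => hs.periodic_orbitSum hw i x

/-- The weighted orbit sums of a nonnegative function are bounded below by its integral `l`. -/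
theorem mul_orbitTotal_le_orbitSum (hα : Irrational (u : CircleDeg1Lift).translationNumber)
    {w U : ℝ → ℝ} {l : ℝ} (hw : Continuous w) (hp : Function.Periodic w 1) (hw0 : ∀ x, 0 ≤ w x)
    (hU : ∀ t, HasDerivAt U (w t) t) (hUl : ∀ t, U (t + 1) = U t + l) {ω : ℝ} (hω : 0 < ω) :
    ∃ n₀ : ℕ, ∀ n ≥ n₀, ∀ y,
      (l - ω) * orbitTotal u d (convDen (u : CircleDeg1Lift).translationNumber n) y ≤
        5 * orbitSum u d (convDen (u : CircleDeg1Lift).translationNumber n) w y := by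
  obtain ⟨δ, hδ, hmod⟩ := exists_modulus_of_periodic hw hp (show 0 < ω / 3 by positivity)
  obtain ⟨n₁, hn₁⟩ := hs.exists_orbitDeriv_le hα (show 0 < δ / 5 by positivity)
  refine ⟨max 1 n₁, fun n hn y => ?_⟩
  obtain ⟨Q, P, h⟩ := exists_approxPair hα (le_of_max_le_left hn)
  have hη := hn₁ n (le_of_max_le_right hn)
  set N := convDen (u : CircleDeg1Lift).translationNumber n with hN
  set z := shift u Q P (shift u Q P y) with hz
  have hyz : y < z := (h.lt_shift y).trans (h.lt_shift _)
  have hS := hs.orbitTotal_pos h.pos y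
  have hSw : 0 ≤ orbitSum u d N w y :=
    Finset.sum_nonneg fun i _ => mul_nonneg (hw0 _) (hs.orbitDeriv_pos _ _).le
  rcases le_total (l - ω) 0 with hl | hl
  · nlinarith
  have hUm : Monotone U := monotone_of_hasDerivAt_nonneg hU hw0
  have hF : ∀ t, HasDerivAt (fun t => ∑ i ∈ Finset.range N, U (orbit u i t))
      (orbitSum u d N w t) t := fun t =>
    HasDerivAt.fun_sum fun i _ => (hU _).comp t (hs.hasDerivAt_orbit i t)
  -- The integrals of w over the images of [y, z] add up to at least l, because these images cover a
  -- full turn; t realizes their mean.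
  obtain ⟨t, ht, hslope⟩ := exists_hasDerivAt_eq_slope _ _ hyz
    (continuous_iff_continuousAt.2 fun t => (hF t).continuousAt).continuousOn fun t _ => hF t
  have hzy : 0 < z - y := sub_pos.2 hyz
  rw [eq_div_iff hzy.ne', ← Finset.sum_sub_distrib] at hslope
  have hl1 : l ≤ orbitSum u d N w t * (z - y) := by
    rw [hslope]
    exact h.le_sum_shift_shift hα hUm (add_int_of_add_one hUl) y
  have htot : ∀ s, y ≤ s → s ≤ z → (z - y) * orbitTotal u d N s ≤ 3 := fun s h1 h2 =>
    h.shift_sub_mul_orbitTotal_le hs hα h1 h2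
  have hterm : ∀ i ∈ Finset.range N, (w (orbit u i t) - ω / 3) * orbitDeriv u d i t ≤
      3 / 2 * (w (orbit u i y) * orbitDeriv u d i y) := by
    intro i hi
    have hiN := (Finset.mem_range.1 hi).le
    have hD := h.orbitDeriv_le hs hα hiN ht.1.le ht.2.le le_rfl hyz.le
    have hDt := hs.orbitDeriv_pos i t
    have hDy := hs.orbitDeriv_pos i y
    rcases le_total (w (orbit u i t) - ω / 3) 0 with h0 | h0
    · have := mul_nonneg (hw0 (orbit u i y)) hDy.le
      nlinarith
    -- The i-th image of [y, z] has length at most 3/2 · δ/5 · 3 = 9δ/10.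
    · have hclose : |orbit u i t - orbit u i y| ≤ δ := by
        obtain ⟨c, hc, hc'⟩ := exists_hasDerivAt_eq_slope (orbit u i) (orbitDeriv u d i) hyz
          (hs.continuous_orbit i).continuousOn fun t _ => hs.hasDerivAt_orbit i t
        rw [eq_div_iff hzy.ne'] at hc'
        have h1 := h.orbitDeriv_le hs hα hiN hc.1.le hc.2.le le_rfl hyz.le
        have h2 := hη y i hiN
        have h3 := htot y le_rfl hyz.le
        have h4 := orbit_mono u i ht.1.le
        have h5 := orbit_mono u i ht.2.le
        rw [abs_of_nonneg (by linarith)]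
        have h6 : orbitDeriv u d i c ≤ 3 / 2 * (δ / 5 * orbitTotal u d N y) := by linarith
        have h7 := mul_le_mul_of_nonneg_right h6 hzy.le
        have h8 : 3 / 2 * (δ / 5 * orbitTotal u d N y) * (z - y) =
          3 / 10 * δ * ((z - y) * orbitTotal u d N y) := by ring
        have h9 := mul_le_mul_of_nonneg_left h3 (show 0 ≤ 3 / 10 * δ by positivity)
        linarith
      have h1 := (abs_le.1 (hmod _ _ hclose)).2
      have h2 : (w (orbit u i t) - ω / 3) * orbitDeriv u d i t ≤
          (w (orbit u i t) - ω / 3) * (3 / 2 * orbitDeriv u d i y) :=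
        mul_le_mul_of_nonneg_left hD h0
      nlinarith
  have hsum := Finset.sum_le_sum hterm
  rw [← Finset.mul_sum] at hsum
  have e1 : ∑ i ∈ Finset.range N, (w (orbit u i t) - ω / 3) * orbitDeriv u d i t =
      orbitSum u d N w t - ω / 3 * orbitTotal u d N t := by
    simp only [sub_mul, Finset.sum_sub_distrib, ← Finset.mul_sum, orbitSum, orbitTotal]
  rw [e1] at hsum
  change _ ≤ 3 / 2 * orbitSum u d N w y at hsum
  have h3 := htot t ht.1.le ht.2.le
  have h4 := htot y le_rfl hyz.le
  have h5 : l - ω ≤ 3 / 2 * orbitSum u d N w y * (z - y) := by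
    have := mul_le_mul_of_nonneg_right hsum hzy.le
    have h6 := mul_le_mul_of_nonneg_left h3 (show 0 ≤ ω / 3 by positivity)
    nlinarith
  -- Multiplying by (z - y) S(y) ≤ 3 turns 3/2 into 9/2 ≤ 5.
  refine le_of_mul_le_mul_right ?_ hzy
  have h6 := mul_le_mul_of_nonneg_left h4 hl
  nlinarith

end LogSmooth

/-- `ϕ ≤ A` up to a continuous twisted coboundary. -/
def CoboundaryLE (u : CircleDeg1Liftˣ) (d ϕ : ℝ → ℝ) (A : ℝ) : Prop :=
  ∃ v : ℝ → ℝ, Continuous v ∧ Function.Periodic v 1 ∧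
    ∀ x, ϕ x ≤ A + (v x - v ((u : CircleDeg1Lift) x) * d x)

theorem CoboundaryLE.mono {ϕ : ℝ → ℝ} {A B : ℝ} (h : CoboundaryLE u d ϕ A) (hAB : A ≤ B) :
    CoboundaryLE u d ϕ B := by
  obtain ⟨v, h1, h2, h3⟩ := h
  exact ⟨v, h1, h2, fun x => (h3 x).trans (by linarith)⟩

/-- The slack w = A + coboundary - ϕ is nonnegative with integral A, since ϕ and twisted
coboundaries have zero mean. Its weighted orbit sums are therefore at least A/10 of the total
derivative for some N, so those of ϕ are at most 9A/10 of it, up to boundary terms of v. Averaging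
modulo coboundaries brings this back to ϕ. -/
theorem LogSmooth.coboundaryLE_step (hs : LogSmooth u d φ)
    (hα : Irrational (u : CircleDeg1Lift).translationNumber) {ϕ Φ : ℝ → ℝ} (hϕ : Continuous ϕ)
    (hϕp : Function.Periodic ϕ 1) (hΦ : ∀ t, HasDerivAt Φ (ϕ t) t) (hΦp : Function.Periodic Φ 1)
    {A : ℝ} (hA : 0 < A) (hcob : CoboundaryLE u d ϕ A) : CoboundaryLE u d ϕ (9 / 10 * A) := by
  obtain ⟨v, hv, hvp, hle⟩ := hcob
  obtain ⟨V, c, hV, hVc⟩ := exists_antideriv_of_periodic hv hvp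
  have hu1 : ∀ x, (u : CircleDeg1Lift) (x + 1) = (u : CircleDeg1Lift) x + 1 :=
    CircleDeg1Lift.map_add_one _
  have huc : Continuous (u : CircleDeg1Lift) :=
    continuous_iff_continuousAt.2 fun x => (hs.hasDerivAt x).continuousAt
  set w : ℝ → ℝ := fun x => A + (v x - v ((u : CircleDeg1Lift) x) * d x) - ϕ x with hw
  have hwc : Continuous w :=
    (continuous_const.add (hv.sub ((hv.comp huc).mul hs.continuous_deriv))).sub hϕ
  have hwp : Function.Periodic w 1 := by
    intro x
    simp only [hw]
    rw [hvp, hu1, hvp, hs.periodic_deriv, hϕp]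
  obtain ⟨n₀, hn₀⟩ := hs.mul_orbitTotal_le_orbitSum hα (w := w)
    (U := fun t => A * t + (V t - V ((u : CircleDeg1Lift) t)) - Φ t) (l := A) hwc hwp
    (fun x => sub_nonneg.2 (hle x))
    (fun t => by
      have h1 := ((hasDerivAt_id t).const_mul A).add
        ((hV t).sub ((hV ((u : CircleDeg1Lift) t)).comp t (hs.hasDerivAt t)))
      have h2 := h1.sub (hΦ t)
      rw [mul_one] at h2
      exact h2)
    (fun t => by rw [hu1, hVc, hVc, hΦp]; ring) (show 0 < A / 2 by positivity)
  have h1 := hn₀ n₀ le_rfl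
  set N := convDen (u : CircleDeg1Lift).translationNumber n₀ with hN
  have hNpos : (0 : ℝ) < N := by exact_mod_cast convDen_pos _ _
  have hone : Function.Periodic (fun _ : ℝ => (1 : ℝ)) 1 := fun _ => rfl
  -- The three terms account for the boundary terms of v, for replacing ϕ by its average, and for
  -- replacing the total derivative by N.
  refine ⟨fun x => (orbitSum u d N v x + orbitDoubleSum u d N ϕ x -
      9 / 10 * A * orbitDoubleSum u d N (fun _ => 1) x) / N, ?_, ?_, fun x => ?_⟩
  · exact (((hs.continuous_orbitSum hv N).add (hs.continuous_orbitDoubleSum hϕ N)).sub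
      (continuous_const.mul (hs.continuous_orbitDoubleSum continuous_const N))).div_const _
  · intro x
    simp only
    rw [hs.periodic_orbitSum hvp N x, hs.periodic_orbitDoubleSum hϕp N x,
      hs.periodic_orbitDoubleSum hone N x]
  · have e1 : orbitSum u d N w x = A * orbitTotal u d N x +
        (v x - v (orbit u N x) * orbitDeriv u d N x) - orbitSum u d N ϕ x := by
      rw [← orbitSum_coboundary, orbitTotal, orbitSum, orbitSum, orbitSum, Finset.mul_sum,
        ← Finset.sum_add_distrib, ← Finset.sum_sub_distrib]
      exact Finset.sum_congr rfl fun i _ => by simp only [hw]; ring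
    have e2 := orbitSum_map (u := u) (d := d) N v x
    have e3 := orbitDoubleSum_sub (u := u) (d := d) N ϕ x
    have e4 := orbitDoubleSum_sub (u := u) (d := d) N (fun _ => 1) x
    rw [orbitSum_one] at e4
    have h2 := h1 x
    rw [e1] at h2
    refine le_of_mul_le_mul_left ?_ hNpos
    have e5 : ∀ a b : ℝ, (N : ℝ) * (9 / 10 * A + (a / N - b / N * d x)) =
        9 / 10 * A * N + (a - b * d x) := by
      intro a b; field_simp
    rw [e5]
    linear_combination (1 / 5 : ℝ) * h2 + e2 - e3 + 9 / 10 * A * e4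

theorem LogSmooth.coboundaryLE (hs : LogSmooth u d φ)
    (hα : Irrational (u : CircleDeg1Lift).translationNumber) {ϕ Φ : ℝ → ℝ} (hϕ : Continuous ϕ)
    (hϕp : Function.Periodic ϕ 1) (hΦ : ∀ t, HasDerivAt Φ (ϕ t) t) (hΦp : Function.Periodic Φ 1)
    {ε : ℝ} (hε : 0 < ε) : CoboundaryLE u d ϕ ε := by
  obtain ⟨B, hB, hle⟩ := exists_bound_of_periodic hϕ hϕp
  have h1 : ∀ k : ℕ, CoboundaryLE u d ϕ ((9 / 10) ^ k * B) := by
    intro k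
    induction k with
    | zero =>
      exact ⟨fun _ => 0, continuous_const, fun _ => rfl, fun x => by
        simpa using (le_abs_self _).trans (hle x)⟩
    | succ k ih =>
      have := hs.coboundaryLE_step hα hϕ hϕp hΦ hΦp (by positivity) ih
      rwa [← mul_assoc, ← pow_succ'] at this
  obtain ⟨k, hk⟩ := exists_pow_lt_of_lt_one (show 0 < ε / B by positivity)
    (show (9 / 10 : ℝ) < 1 by norm_num)
  exact (h1 k).mono ((lt_div_iff₀ hB).1 hk).le

/-- The coboundary contributes at most B(1 + Dg^j), where B bounds |v|; both 1 = Dg^0 and Dg^j are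
negligible against S. -/
theorem LogSmooth.orbitSum_le (hs : LogSmooth u d φ)
    (hα : Irrational (u : CircleDeg1Lift).translationNumber) {ϕ Φ : ℝ → ℝ} (hϕ : Continuous ϕ)
    (hϕp : Function.Periodic ϕ 1) (hΦ : ∀ t, HasDerivAt Φ (ϕ t) t) (hΦp : Function.Periodic Φ 1)
    {ε : ℝ} (hε : 0 < ε) :
    ∃ n₀ : ℕ, ∀ n ≥ n₀, ∀ x, ∀ j ≤ convDen (u : CircleDeg1Lift).translationNumber n,
      orbitSum u d j ϕ x ≤
        ε * orbitTotal u d (convDen (u : CircleDeg1Lift).translationNumber n) x := by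
  obtain ⟨v, hv, hvp, hle⟩ := hs.coboundaryLE hα hϕ hϕp hΦ hΦp (half_pos hε)
  obtain ⟨B, hB, hvB⟩ := exists_bound_of_periodic hv hvp
  obtain ⟨n₀, hn₀⟩ := hs.exists_orbitDeriv_le hα (show 0 < ε / (4 * B) by positivity)
  refine ⟨n₀, fun n hn x j hj => ?_⟩
  set N := convDen (u : CircleDeg1Lift).translationNumber n
  have h1 : orbitSum u d j ϕ x ≤ ε / 2 * orbitTotal u d j x +
      (v x - v (orbit u j x) * orbitDeriv u d j x) := by
    rw [← orbitSum_coboundary, orbitTotal, orbitSum, orbitSum, Finset.mul_sum,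
      ← Finset.sum_add_distrib]
    refine Finset.sum_le_sum fun i _ => ?_
    have := mul_le_mul_of_nonneg_right (hle (orbit u i x)) (hs.orbitDeriv_pos i x).le
    linarith
  have h2 := hs.orbitTotal_mono hj x
  have h3 := hn₀ n hn x 0 (Nat.zero_le _)
  have h4 := hn₀ n hn x j hj
  rw [orbitDeriv_zero] at h3
  have h5 := (abs_le.1 (hvB x)).2
  have h6 := (abs_le.1 (hvB (orbit u j x))).1
  have h7 := hs.orbitDeriv_pos j x
  have h8 : ε / (4 * B) * orbitTotal u d N x * B = ε / 4 * orbitTotal u d N x := by field_simp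
  have h9 := mul_le_mul_of_nonneg_right h3 hB.le
  have h10 := mul_le_mul_of_nonneg_right h4 hB.le
  have h11 := mul_le_mul_of_nonneg_left h2 (half_pos hε).le
  nlinarith

/-- The nonlinearities of the iterates of order at most `q_n` are small at the scale
`1 / orbitTotal`. -/
theorem LogSmooth.abs_orbitSum_le (hs : LogSmooth u d φ)
    (hα : Irrational (u : CircleDeg1Lift).translationNumber) {ε : ℝ} (hε : 0 < ε) :
    ∃ n₀ : ℕ, ∀ n ≥ n₀, ∀ x, ∀ j ≤ convDen (u : CircleDeg1Lift).translationNumber n,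
      |orbitSum u d j φ x| ≤
        ε * orbitTotal u d (convDen (u : CircleDeg1Lift).translationNumber n) x := by
  have hp : Function.Periodic (fun t => Real.log (d t)) 1 := fun t => by
    simp only [hs.periodic_deriv t]
  obtain ⟨n₁, h₁⟩ := hs.orbitSum_le hα hs.cont hs.periodic_logDeriv hs.hasDerivAt_log_deriv hp hε
  obtain ⟨n₂, h₂⟩ := hs.orbitSum_le hα (ϕ := fun t => -φ t) hs.cont.neg
    (fun t => by simp only [hs.periodic_logDeriv t]) (fun t => (hs.hasDerivAt_log_deriv t).neg)
    (fun t => by simp only [Pi.neg_apply, hp t]) hε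
  refine ⟨max n₁ n₂, fun n hn x j hj => abs_le'.2 ⟨h₁ n (le_of_max_le_left hn) x j hj, ?_⟩⟩
  have := h₂ n (le_of_max_le_right hn) x j hj
  simpa [orbitSum] using this

/-! ### Convergence of the closest returns to the identity in the `C¹` topology -/

namespace LogSmooth

variable (hs : LogSmooth u d φ)
include hs

theorem hasDerivAt_orbitDeriv (i : ℕ) (x : ℝ) :
    HasDerivAt (orbitDeriv u d i) (orbitDeriv u d i x * orbitSum u d i φ x) x := by
  induction i with
  | zero =>
    have : orbitDeriv u d 0 = fun _ => 1 := funext fun y => by simp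
    rw [this]
    simpa [orbitSum] using hasDerivAt_const x (1 : ℝ)
  | succ i ih =>
    have : orbitDeriv u d (i + 1) = fun y => orbitDeriv u d i y * d (orbit u i y) :=
      funext fun y => orbitDeriv_succ i y
    rw [this, orbitSum_succ]
    refine (ih.mul ((hs.hasDerivAt_deriv (orbit u i x)).comp x
      (hs.hasDerivAt_orbit i x))).congr_deriv ?_
    simp only [Function.comp]
    ring

theorem hasDerivAt_orbitTotal (N : ℕ) (x : ℝ) : HasDerivAt (orbitTotal u d N)
    (∑ i ∈ Finset.range N, orbitDeriv u d i x * orbitSum u d i φ x) x :=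
  HasDerivAt.fun_sum fun i _ => hs.hasDerivAt_orbitDeriv i x

/-- The derivative of S is a sum of Dg^i · D log Dg^i, hence at most ε S² in modulus. -/
theorem abs_inv_orbitTotal_sub_le {N : ℕ} (hN : 0 < N) {ε : ℝ}
    (h : ∀ x, ∀ j ≤ N, |orbitSum u d j φ x| ≤ ε * orbitTotal u d N x) (x y : ℝ) :
    |(orbitTotal u d N y)⁻¹ - (orbitTotal u d N x)⁻¹| ≤ ε * |y - x| := by
  refine Convex.norm_image_sub_le_of_norm_hasDerivWithin_le
    (fun z _ => ((hs.hasDerivAt_orbitTotal N z).fun_inv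
      (hs.orbitTotal_pos hN z).ne').hasDerivWithinAt)
    (fun z _ => ?_) convex_univ (Set.mem_univ x) (Set.mem_univ y)
  have hS := hs.orbitTotal_pos hN z
  rw [Real.norm_eq_abs, abs_div, abs_neg, abs_pow, abs_of_pos hS, div_le_iff₀ (by positivity)]
  refine (Finset.abs_sum_le_sum_abs _ _).trans ?_
  have : ε * orbitTotal u d N z ^ 2 =
      ∑ i ∈ Finset.range N, orbitDeriv u d i z * (ε * orbitTotal u d N z) := by
    rw [← Finset.sum_mul, orbitTotal]; ring
  rw [this]
  refine Finset.sum_le_sum fun i hi => ?_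
  rw [abs_mul, abs_of_pos (hs.orbitDeriv_pos i z)]
  exact mul_le_mul_of_nonneg_left (h z i (Finset.mem_range.1 hi).le) (hs.orbitDeriv_pos i z).le

end LogSmooth

theorem ApproxPair.return_pos_or_neg {N : ℕ} {R Q P : ℤ}
    (h : ApproxPair (u : CircleDeg1Lift).translationNumber N R Q P)
    (hα : Irrational (u : CircleDeg1Lift).translationNumber) :
    (∀ x, 0 < orbit u N x - R - x) ∨ ∀ x, orbit u N x - R - x < 0 := by
  have hne : (N : ℝ) * (u : CircleDeg1Lift).translationNumber - R ≠ 0 := by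
    have := (hα.natCast_mul h.pos.ne').ne_int R
    exact sub_ne_zero.2 this
  rcases hne.lt_or_gt with h1 | h1
  · right; intro x
    have := orbit_add_lt_orbit_add (u := u) (k := N) (p := -R) (l := 0) (r := 0)
      (by push_cast; linarith) x
    push_cast at this
    rw [orbit_zero] at this
    linarith
  · left; intro x
    have := orbit_add_lt_orbit_add (u := u) (k := 0) (p := 0) (l := N) (r := -R)
      (by push_cast; linarith) x
    push_cast at this
    rw [orbit_zero] at this
    linarith

/-- If Dg^N - 1 exceeded δ in modulus at x, it would stay beyond δ/2, with the same sign, within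
distance s of x. The displacement, at most 3/S(x) at x, would then change by more than 4/S(x) on
either side and take both signs, whereas it never vanishes. -/
theorem ApproxPair.abs_orbitDeriv_sub_one_le {N : ℕ} {R Q P : ℤ} (hs : LogSmooth u d φ)
    (h : ApproxPair (u : CircleDeg1Lift).translationNumber N R Q P)
    (hα : Irrational (u : CircleDeg1Lift).translationNumber) {δ ε : ℝ} (hδ : 0 < δ)
    (hε0 : 0 < ε) (hε1 : ε ≤ δ / 16) (hε2 : ε ≤ δ ^ 2 / 96)
    (hsum : ∀ x, ∀ j ≤ N, |orbitSum u d j φ x| ≤ ε * orbitTotal u d N x) (x : ℝ) :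
    |orbitDeriv u d N x - 1| ≤ δ := by
  have hS := hs.orbitTotal_pos h.pos x
  -- Chosen so that δ/2 · s = 4/S(x).
  set s : ℝ := 8 / δ / orbitTotal u d N x with hsdef
  have hspos : 0 < s := by positivity
  have hsS : s * orbitTotal u d N x = 8 / δ := by rw [hsdef]; field_simp
  have htot : ∀ y, |y - x| ≤ s → orbitTotal u d N y ≤ 2 * orbitTotal u d N x := by
    intro y hy
    have h1 := (abs_le.1 (hs.abs_inv_orbitTotal_sub_le h.pos hsum x y)).1
    have hSy := hs.orbitTotal_pos h.pos y
    have h2 : ε * |y - x| ≤ (orbitTotal u d N x)⁻¹ / 2 := by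
      have h3 : ε * |y - x| ≤ δ / 16 * s := mul_le_mul hε1 hy (abs_nonneg _) (by positivity)
      have h4 : δ / 16 * s = (orbitTotal u d N x)⁻¹ / 2 := by rw [hsdef]; field_simp; norm_num
      linarith
    have h3 : (orbitTotal u d N x)⁻¹ / 2 ≤ (orbitTotal u d N y)⁻¹ := by linarith
    have h4 : (2 * orbitTotal u d N x)⁻¹ ≤ (orbitTotal u d N y)⁻¹ := by
      rw [mul_inv]; linarith
    exact (inv_le_inv₀ (by positivity) hSy).1 h4
  have hvar : ∀ y ∈ Set.Icc (x - s) (x + s),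
      |orbitDeriv u d N y - orbitDeriv u d N x| ≤ δ / 2 := by
    intro y hy
    have hyx : |y - x| ≤ s := abs_le.2 ⟨by linarith [hy.1], by linarith [hy.2]⟩
    have h1 := Convex.norm_image_sub_le_of_norm_hasDerivWithin_le (s := Set.Icc (x - s) (x + s))
      (C := 6 * ε * orbitTotal u d N x)
      (fun z _ => (hs.hasDerivAt_orbitDeriv N z).hasDerivWithinAt)
      (fun z hz => ?_) (convex_Icc _ _) (show x ∈ Set.Icc (x - s) (x + s) from ⟨by linarith, by linarith⟩) hy
    · rw [Real.norm_eq_abs, Real.norm_eq_abs] at h1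
      refine h1.trans ?_
      have h2 : 6 * ε * orbitTotal u d N x * |y - x| ≤ 6 * ε * orbitTotal u d N x * s := by
        gcongr
      have h3 : 6 * ε * orbitTotal u d N x * s = 48 * ε / δ := by
        rw [mul_assoc, mul_comm (orbitTotal u d N x), hsS]; ring
      have h4 : 48 * ε / δ ≤ δ / 2 := by
        rw [div_le_iff₀ hδ]; nlinarith
      linarith
    · have hzx : |z - x| ≤ s := abs_le.2 ⟨by linarith [hz.1], by linarith [hz.2]⟩
      have h2 := hsum z N le_rfl
      have h3 := htot z hzx
      have h4 := (h.orbitDeriv_bounds hs hα z).1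
      rw [Real.norm_eq_abs, abs_mul, abs_of_pos (hs.orbitDeriv_pos N z)]
      calc orbitDeriv u d N z * |orbitSum u d N φ z|
          ≤ 3 * (ε * (2 * orbitTotal u d N x)) := by
            refine mul_le_mul h4 (h2.trans ?_) (abs_nonneg _) (by norm_num)
            gcongr
        _ = 6 * ε * orbitTotal u d N x := by ring
  set m : ℝ → ℝ := fun y => orbit u N y - R - y with hm
  have hmd : ∀ y, HasDerivAt m (orbitDeriv u d N y - 1) y := fun y =>
    ((hs.hasDerivAt_orbit N y).sub_const _).sub (hasDerivAt_id y)
  have hmc : Continuous m := continuous_iff_continuousAt.2 fun y => (hmd y).continuousAt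
  have hmx : |m x| < 4 * (orbitTotal u d N x)⁻¹ := by
    have := h.abs_return_mul_orbitTotal_le hs hα x
    rw [← div_eq_mul_inv, lt_div_iff₀ hS]
    linarith
  have hss : δ / 2 * s = 4 * (orbitTotal u d N x)⁻¹ := by rw [hsdef]; field_simp; norm_num
  have hmx' := abs_lt.1 hmx
  obtain ⟨a, ha, ha'⟩ := exists_hasDerivAt_eq_slope m _ (show x - s < x by linarith)
    hmc.continuousOn fun y _ => hmd y
  obtain ⟨b, hb, hb'⟩ := exists_hasDerivAt_eq_slope m _ (show x < x + s by linarith)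
    hmc.continuousOn fun y _ => hmd y
  rw [eq_div_iff (by linarith)] at ha' hb'
  have hva := abs_le.1 (hvar a ⟨ha.1.le, by linarith [ha.2]⟩)
  have hvb := abs_le.1 (hvar b ⟨by linarith [hb.1], hb.2.le⟩)
  have hsign : ¬(0 < m (x + s) ∧ m (x - s) < 0) ∧ ¬(m (x + s) < 0 ∧ 0 < m (x - s)) := by
    rcases h.return_pos_or_neg hα with h1 | h1
    · exact ⟨fun h2 => (h1 (x - s)).not_gt h2.2, fun h2 => (h1 (x + s)).not_gt h2.1⟩
    · exact ⟨fun h2 => (h1 (x + s)).not_gt h2.1, fun h2 => (h1 (x - s)).not_gt h2.2⟩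
  refine abs_le.2 ⟨?_, ?_⟩
  · by_contra! hlt
    refine hsign.2 ⟨?_, ?_⟩ <;> nlinarith
  · by_contra! hlt
    refine hsign.1 ⟨?_, ?_⟩ <;> nlinarith

/-- Splitting the sum of the first N + j derivatives in two ways, the difference becomes the sum
over i < j of (Dg^N(g^i x) - 1) Dg^i(x). -/
theorem LogSmooth.abs_orbitTotal_orbit_sub_le (hs : LogSmooth u d φ) {N : ℕ} {δ : ℝ}
    (h : ∀ x, |orbitDeriv u d N x - 1| ≤ δ) {j : ℕ} (hj : j ≤ N) (x : ℝ) :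
    |orbitTotal u d N (orbit u j x) * orbitDeriv u d j x - orbitTotal u d N x| ≤
      δ * orbitTotal u d N x := by
  have hδ : 0 ≤ δ := (abs_nonneg _).trans (h x)
  have h1 := Finset.sum_range_add (fun i => orbitDeriv u d i x) j N
  have h2 := Finset.sum_range_add (fun i => orbitDeriv u d i x) N j
  rw [add_comm j N, h2] at h1
  have h3 : ∀ i, orbitDeriv u d (j + i) x = orbitDeriv u d i (orbit u j x) * orbitDeriv u d j x :=
    fun i => by rw [add_comm, orbitDeriv_add]
  have h4 : ∀ i, orbitDeriv u d (N + i) x = orbitDeriv u d N (orbit u i x) * orbitDeriv u d i x :=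
    fun i => by rw [orbitDeriv_add]
  simp only [h3, h4, ← Finset.sum_mul] at h1
  have h5 : orbitTotal u d N (orbit u j x) * orbitDeriv u d j x - orbitTotal u d N x =
      ∑ i ∈ Finset.range j, (orbitDeriv u d N (orbit u i x) - 1) * orbitDeriv u d i x := by
    simp only [sub_mul, one_mul, Finset.sum_sub_distrib]
    simp only [orbitTotal]
    linarith
  rw [h5]
  refine (Finset.abs_sum_le_sum_abs _ _).trans
    (le_trans ?_ (mul_le_mul_of_nonneg_left (hs.orbitTotal_mono hj x) hδ))
  rw [orbitTotal, Finset.mul_sum]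
  refine Finset.sum_le_sum fun i _ => ?_
  rw [abs_mul, abs_of_pos (hs.orbitDeriv_pos i x)]
  exact mul_le_mul_of_nonneg_right (h _) (hs.orbitDeriv_pos i x).le

/-! ### The complex extension -/

theorem hasDerivAt_re_of_real_on_real {F : ℂ → ℂ} {f : ℝ → ℝ} (hF : ∀ x : ℝ, F x = (f x : ℝ))
    {x : ℝ} (hd : DifferentiableAt ℂ F x) :
    HasDerivAt f (deriv F x).re x ∧ deriv F x = ((deriv F x).re : ℝ) := by
  have h1 : HasDerivAt f (deriv F x).re x := by
    have := hd.hasDerivAt.real_of_complex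
    simpa only [hF, Complex.ofReal_re] using this
  refine ⟨h1, ?_⟩
  have h2 := hd.hasDerivAt.comp_ofReal
  simp only [hF] at h2
  exact h2.unique h1.ofReal_comp

theorem isOpen_strip (Δ : ℝ) : IsOpen (strip Δ) :=
  isOpen_lt (by fun_prop) continuous_const

theorem strip_subset_closedStrip (Δ : ℝ) : strip Δ ⊆ closedStrip Δ := fun z hz =>
  show |z.im| ≤ Δ from le_of_lt hz

theorem ofReal_mem_strip {Δ : ℝ} (hΔ : 0 < Δ) (x : ℝ) : (x : ℂ) ∈ strip Δ := by
  simpa [strip] using hΔ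

theorem add_one_mem_strip {Δ : ℝ} {z : ℂ} : z + 1 ∈ strip Δ ↔ z ∈ strip Δ := by
  simp [strip]

namespace IsStripExtension

variable {Δ : ℝ} {g : CircleDeg1Lift} {G : ℂ → ℂ} (h : IsStripExtension Δ g G)
include h

theorem differentiableOn_strip : DifferentiableOn ℂ G (strip Δ) := by
  obtain ⟨Ω, Ω', H, -, -, hs, -, hG, -⟩ := h.diffeo
  exact hG.mono ((strip_subset_closedStrip Δ).trans hs)

theorem hasDerivAt {z : ℂ} (hz : z ∈ strip Δ) : HasDerivAt G (deriv G z) z :=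
  (h.differentiableOn_strip.differentiableAt ((isOpen_strip Δ).mem_nhds hz)).hasDerivAt

theorem differentiableOn_deriv : DifferentiableOn ℂ (deriv G) (strip Δ) :=
  h.differentiableOn_strip.deriv (isOpen_strip Δ)

theorem hasDerivAt_deriv {z : ℂ} (hz : z ∈ strip Δ) :
    HasDerivAt (deriv G) (deriv (deriv G) z) z :=
  (h.differentiableOn_deriv.differentiableAt ((isOpen_strip Δ).mem_nhds hz)).hasDerivAt

theorem continuousOn_deriv_deriv : ContinuousOn (deriv (deriv G)) (strip Δ) :=
  (h.differentiableOn_deriv.deriv (isOpen_strip Δ)).continuousOn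

theorem deriv_add_one {z : ℂ} (hz : z ∈ strip Δ) : deriv G (z + 1) = deriv G z := by
  have h1 : (fun w => G (w + 1)) =ᶠ[nhds z] fun w => G w + 1 := by
    filter_upwards [(isOpen_strip Δ).mem_nhds hz] with w hw using h.add_one hw
  rw [← deriv_comp_add_const, h1.deriv_eq, deriv_add_const]

theorem deriv_deriv_add_one {z : ℂ} (hz : z ∈ strip Δ) :
    deriv (deriv G) (z + 1) = deriv (deriv G) z := by
  rw [← deriv_comp_add_const]
  refine Filter.EventuallyEq.deriv_eq ?_
  filter_upwards [(isOpen_strip Δ).mem_nhds hz] with w hw using h.deriv_add_one hw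

theorem exists_modulus_deriv_deriv (hΔ : 0 < Δ) {ε : ℝ} (hε : 0 < ε) :
    ∃ ρ > 0, ρ < Δ ∧ ∀ (x : ℝ) (ζ : ℂ), ‖ζ‖ ≤ ρ →
      ‖deriv (deriv G) (x + ζ) - deriv (deriv G) x‖ ≤ ε := by
  -- Extension by zero makes the function periodic on the whole plane, so integer translations need
  -- no membership check.
  set f : ℂ → ℂ := (strip Δ).indicator (deriv (deriv G)) with hf
  have hper : Function.Periodic f 1 := by
    intro z
    by_cases hz : z ∈ strip Δ
    · rw [hf, Set.indicator_of_mem (add_one_mem_strip.2 hz), Set.indicator_of_mem hz,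
        h.deriv_deriv_add_one hz]
    · rw [hf, Set.indicator_of_notMem (mt add_one_mem_strip.1 hz), Set.indicator_of_notMem hz]
  have hK : IsCompact (Set.Icc (-1 : ℝ) 2 ×ℂ Set.Icc (-(Δ / 2)) (Δ / 2)) :=
    isCompact_Icc.reProdIm isCompact_Icc
  have hsub : Set.Icc (-1 : ℝ) 2 ×ℂ Set.Icc (-(Δ / 2)) (Δ / 2) ⊆ strip Δ := by
    intro z hz
    have := (Complex.mem_reProdIm.1 hz).2
    show |z.im| < Δ
    exact abs_lt.2 ⟨by linarith [this.1], by linarith [this.2]⟩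
  have huc := hK.uniformContinuousOn_of_continuous (h.continuousOn_deriv_deriv.mono hsub)
  obtain ⟨δ, hδ, hmod⟩ := Metric.uniformContinuousOn_iff_le.1 huc ε hε
  refine ⟨min δ (min 1 (Δ / 2)), by positivity,
    lt_of_le_of_lt ((min_le_right _ _).trans (min_le_right _ _)) (by linarith),
    fun x ζ hζ => ?_⟩
  have h1 : ‖ζ‖ ≤ δ := hζ.trans (min_le_left _ _)
  have h2 : ‖ζ‖ ≤ 1 := hζ.trans ((min_le_right _ _).trans (min_le_left _ _))
  have h3 : ‖ζ‖ ≤ Δ / 2 := hζ.trans ((min_le_right _ _).trans (min_le_right _ _))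
  have hre := abs_le.1 ((Complex.abs_re_le_norm ζ).trans h2)
  have him := abs_le.1 ((Complex.abs_im_le_norm ζ).trans h3)
  have hfl := Int.floor_le x
  have hfl' := Int.lt_floor_add_one x
  have hfr := Int.fract_nonneg x
  have hfr' := Int.fract_lt_one x
  have hm1 : (x + ζ : ℂ) - ⌊x⌋ ∈ Set.Icc (-1 : ℝ) 2 ×ℂ Set.Icc (-(Δ / 2)) (Δ / 2) := by
    refine Complex.mem_reProdIm.2 ⟨⟨?_, ?_⟩, ⟨?_, ?_⟩⟩ <;> simp <;> linarith
  have hm2 : (x : ℂ) - ⌊x⌋ ∈ Set.Icc (-1 : ℝ) 2 ×ℂ Set.Icc (-(Δ / 2)) (Δ / 2) := by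
    refine Complex.mem_reProdIm.2 ⟨⟨?_, ?_⟩, ⟨?_, ?_⟩⟩ <;> simp <;> linarith
  have hshift : ∀ z : ℂ, f (z - ⌊x⌋) = f z := by
    intro z
    have := hper.sub_int_mul_eq (x := z) ⌊x⌋
    simpa using this
  have hx : (x : ℂ) ∈ strip Δ := ofReal_mem_strip hΔ x
  have hxζ : (x + ζ : ℂ) ∈ strip Δ := by
    have : |(x + ζ : ℂ).im| < Δ := by simpa using abs_lt.2 ⟨by linarith, by linarith⟩
    exact this
  have h4 := hmod _ hm1 _ hm2 (by
    rw [dist_eq_norm]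
    refine le_trans (le_of_eq ?_) h1
    congr 1; ring)
  rw [dist_eq_norm, ← Set.indicator_of_mem (hsub hm1) (deriv (deriv G)),
    ← Set.indicator_of_mem (hsub hm2) (deriv (deriv G)), ← hf, hshift, hshift, hf,
    Set.indicator_of_mem hx, Set.indicator_of_mem hxζ] at h4
  exact h4

/-- Second order expansion at real points, uniform in the point. -/
theorem exists_taylor_two (hΔ : 0 < Δ) {ε : ℝ} (hε : 0 < ε) :
    ∃ ρ > 0, ρ < Δ ∧ ∀ (x : ℝ) (ζ : ℂ), ‖ζ‖ ≤ ρ →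
      ‖G (x + ζ) - G x - deriv G x * ζ - deriv (deriv G) x * ζ ^ 2 / 2‖ ≤ ε * ‖ζ‖ ^ 2 := by
  obtain ⟨ρ, hρ, hρΔ, hmod⟩ := h.exists_modulus_deriv_deriv hΔ hε
  refine ⟨ρ, hρ, hρΔ, fun x ζ hζ => ?_⟩
  have hmem : ∀ w ∈ Metric.closedBall (0 : ℂ) ρ, (x + w : ℂ) ∈ strip Δ := by
    intro w hw
    have h1 := (Complex.abs_im_le_norm w).trans (mem_closedBall_zero_iff.1 hw)
    have : |(x + w : ℂ).im| < Δ := by simpa using lt_of_le_of_lt h1 hρΔ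
    exact this
  have hfirst : ∀ w ∈ Metric.closedBall (0 : ℂ) ρ,
      ‖deriv G (x + w) - deriv G x - deriv (deriv G) x * w‖ ≤ ε * ‖w‖ := by
    intro w hw
    have := Convex.norm_image_sub_le_of_norm_hasDerivWithin_le (𝕜 := ℂ)
      (f := fun w => deriv G (x + w) - deriv (deriv G) x * w)
      (f' := fun w => deriv (deriv G) (x + w) - deriv (deriv G) x)
      (s := Metric.closedBall (0 : ℂ) ρ) (C := ε) (x := 0) (y := w)
      (fun z hz => by
        have h1 := (h.hasDerivAt_deriv (hmem z hz)).comp_const_add (x : ℂ) z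
        have h2 := h1.sub ((hasDerivAt_id z).const_mul (deriv (deriv G) x))
        rw [mul_one] at h2
        exact h2.hasDerivWithinAt)
      (fun z hz => hmod x z (mem_closedBall_zero_iff.1 hz)) (convex_closedBall _ _)
      (Metric.mem_closedBall_self hρ.le) hw
    simp only [add_zero, mul_zero, sub_zero] at this
    refine le_trans (le_of_eq (congrArg norm ?_)) this
    ring
  have hball : Metric.closedBall (0 : ℂ) ‖ζ‖ ⊆ Metric.closedBall (0 : ℂ) ρ :=
    Metric.closedBall_subset_closedBall hζ
  have := Convex.norm_image_sub_le_of_norm_hasDerivWithin_le (𝕜 := ℂ)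
    (f := fun w => G (x + w) - deriv G x * w - deriv (deriv G) x * w ^ 2 / 2)
    (f' := fun w => deriv G (x + w) - deriv G x - deriv (deriv G) x * w)
    (s := Metric.closedBall (0 : ℂ) ‖ζ‖) (C := ε * ‖ζ‖) (x := 0) (y := ζ)
    (fun z hz => by
      have h1 := (h.hasDerivAt (hmem z (hball hz))).comp_const_add (x : ℂ) z
      have h2 := h1.sub ((hasDerivAt_id z).const_mul (deriv G x))
      have h3 := h2.sub ((((hasDerivAt_id z).pow 2).const_mul (deriv (deriv G) x)).div_const 2)
      refine (h3.congr_deriv ?_).hasDerivWithinAt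
      simp
      ring)
    (fun z hz => (hfirst z (hball hz)).trans
      (mul_le_mul_of_nonneg_left (mem_closedBall_zero_iff.1 hz) hε.le)) (convex_closedBall _ _)
    (Metric.mem_closedBall_self (norm_nonneg _)) (by simp)
  simp only [add_zero, mul_zero, sub_zero, ne_eq, OfNat.ofNat_ne_zero, not_false_eq_true, zero_pow,
    zero_div] at this
  rw [pow_two ‖ζ‖, ← mul_assoc]
  refine le_trans (le_of_eq (congrArg norm ?_)) this
  ring

end IsStripExtension

/-- An analytic diffeomorphism is a unit of the monoid of lifts. -/
theorem IsAnalyticDiffeo.exists_unit {g : CircleDeg1Lift} (hg : IsAnalyticDiffeo g) :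
    ∃ u : CircleDeg1Liftˣ, (u : CircleDeg1Lift) = g := by
  obtain ⟨k, -, h1, h2⟩ := hg.inverse
  have hmono : Monotone k := by
    intro x y hxy
    by_contra! hlt
    have := g.monotone hlt.le
    rw [h2, h2] at this
    rw [le_antisymm hxy this] at hlt
    exact lt_irrefl _ hlt
  have hadd : ∀ x, k (x + 1) = k x + 1 := by
    intro x
    rw [← h1 (k x + 1), g.map_add_one, h2]
  refine ⟨⟨g, ⟨⟨k, hmono⟩, hadd⟩, ?_, ?_⟩, rfl⟩
  · ext x; exact h2 x
  · ext x; exact h1 x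

theorem IsAnalyticDiffeo.deriv_pos {g : CircleDeg1Lift} (hg : IsAnalyticDiffeo g) {x d : ℝ}
    (hd : HasDerivAt g d x) : 0 < d := by
  obtain ⟨k, hk, h1, -⟩ := hg.inverse
  have h2 := ((hk (g x) (Set.mem_univ _)).differentiableAt.hasDerivAt).comp x hd
  have h3 : k ∘ g = id := funext h1
  rw [h3] at h2
  have h4 := h2.unique (hasDerivAt_id x)
  have h5 : 0 ≤ d := hd.deriv ▸ g.monotone.deriv_nonneg
  refine h5.lt_of_ne ?_
  rintro rfl
  simp at h4

theorem IsStripExtension.exists_logSmooth {Δ : ℝ} (hΔ : 0 < Δ) {g : CircleDeg1Lift}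
    (hg : IsAnalyticDiffeo g) {G : ℂ → ℂ} (hG : IsStripExtension Δ g G)
    (hτ : ∃ τ : ℝ, τ < 1 / 9 ∧ ∀ z ∈ strip Δ, ‖logDeriv (deriv G) z‖ ≤ τ) :
    ∃ (u : CircleDeg1Liftˣ) (d φ : ℝ → ℝ), (u : CircleDeg1Lift) = g ∧ LogSmooth u d φ ∧
      (∀ x : ℝ, deriv G x = (d x : ℝ)) ∧ ∀ x : ℝ, deriv (deriv G) x = ((φ x * d x : ℝ) : ℂ) := by
  obtain ⟨u, rfl⟩ := hg.exists_unit
  obtain ⟨τ, hτ9, hτ⟩ := hτ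
  have hmem := ofReal_mem_strip hΔ
  have h1 := fun x : ℝ => hasDerivAt_re_of_real_on_real hG.agrees
    (hG.hasDerivAt (hmem x)).differentiableAt
  have hpos : ∀ x : ℝ, 0 < (deriv G x).re := fun x => hg.deriv_pos (h1 x).1
  have h2 := fun x : ℝ => hasDerivAt_re_of_real_on_real (fun x => (h1 x).2)
    (hG.hasDerivAt_deriv (hmem x)).differentiableAt
  have hmul : ∀ x : ℝ, (deriv (deriv G) x).re / (deriv G x).re * (deriv G x).re =
      (deriv (deriv G) x).re := fun x => div_mul_cancel₀ _ (hpos x).ne'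
  have hcont : ∀ {F : ℂ → ℂ}, ContinuousOn F (strip Δ) → Continuous fun x : ℝ => (F x).re :=
    fun hF => Complex.continuous_re.comp (hF.comp_continuous Complex.continuous_ofReal hmem)
  refine ⟨u, fun x => (deriv G x).re, fun x => (deriv (deriv G) x).re / (deriv G x).re, rfl,
    ⟨fun x => (h1 x).1, hpos, fun x => by rw [hmul]; exact (h2 x).1, fun x => ?_, ?_⟩,
    fun x => (h1 x).2, fun x => by simp only [hmul]; exact (h2 x).2⟩
  · have h3 := hτ x (hmem x)
    rw [logDeriv_apply, (h1 x).2, (h2 x).2, ← Complex.ofReal_div, Complex.norm_real] at h3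
    exact h3.trans hτ9.le
  · exact (hcont hG.continuousOn_deriv_deriv).div (hcont hG.differentiableOn_deriv.continuousOn)
      fun x => (hpos x).ne'

/-! ### Iterates near the real line -/

/-- Here t is the inverse of the ratio of the true increment to the linear one, which is 1 + φζ/2 to
first order. The inverse is used because its corrections add up along an orbit. -/
theorem IsStripExtension.exists_step {Δ : ℝ} (hΔ : 0 < Δ) {g : CircleDeg1Lift} {G : ℂ → ℂ}
    (hG : IsStripExtension Δ g G) (hs : LogSmooth u d φ) (hd : ∀ x : ℝ, deriv G x = (d x : ℝ))
    (hφ : ∀ x : ℝ, deriv (deriv G) x = ((φ x * d x : ℝ) : ℂ)) {δ : ℝ} (hδ : 0 < δ) (hδ1 : δ ≤ 1) :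
    ∃ ρ > 0, ρ < Δ ∧ ∀ (x : ℝ) (ζ : ℂ), ‖ζ‖ ≤ ρ →
      ∃ t : ℂ, (G (x + ζ) - G x) * t = d x * ζ ∧ ‖t - 1 + φ x * ζ / 2‖ ≤ δ * ‖ζ‖ := by
  obtain ⟨B, hB, hBd⟩ := exists_bound_of_periodic (w := fun x => (d x)⁻¹)
    (hs.continuous_deriv.inv₀ fun x => (hs.pos x).ne')
    (fun x => by simp only [hs.periodic_deriv x])
  obtain ⟨ρ, hρ, hρΔ, htaylor⟩ := hG.exists_taylor_two hΔ (show 0 < δ / 4 / B by positivity)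
  refine ⟨min ρ δ, by positivity, lt_of_le_of_lt (min_le_left _ _) hρΔ, fun x ζ hζ => ?_⟩
  have hζρ := hζ.trans (min_le_left _ _)
  have hζδ := hζ.trans (min_le_right _ _)
  rcases eq_or_ne ζ 0 with rfl | hζ0
  · exact ⟨1, by simp, by simp⟩
  have hdx := hs.pos x
  have hdx' : (d x : ℂ) ≠ 0 := by exact_mod_cast hdx.ne'
  set κ : ℂ := (G (x + ζ) - G x) / (d x * ζ) with hκ
  have hκe : G (x + ζ) - G x = d x * ζ * κ := by
    rw [hκ, mul_div_cancel₀ _ (mul_ne_zero hdx' hζ0)]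
  have hn : 0 < ‖ζ‖ := norm_pos_iff.2 hζ0
  have h1 : ‖κ - 1 - φ x * ζ / 2‖ ≤ δ / 4 * ‖ζ‖ := by
    have h2 := htaylor x ζ hζρ
    rw [hd, hφ, hκe] at h2
    have h3 : (d x * ζ * κ - (d x : ℝ) * ζ - ((φ x * d x : ℝ) : ℂ) * ζ ^ 2 / 2 : ℂ) =
        (d x * ζ) * (κ - 1 - φ x * ζ / 2) := by push_cast; ring
    rw [h3, norm_mul, norm_mul, Complex.norm_real, Real.norm_eq_abs, abs_of_pos hdx] at h2
    have h4 : 1 ≤ B * d x := by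
      have := (le_abs_self _).trans (hBd x)
      rwa [← div_le_iff₀ hdx, one_div]
    have h5 : d x * ‖κ - 1 - φ x * ζ / 2‖ ≤ δ / 4 / B * ‖ζ‖ := by
      refine le_of_mul_le_mul_right ?_ hn
      linarith
    have h6 : ‖κ - 1 - φ x * ζ / 2‖ ≤ B * (d x * ‖κ - 1 - φ x * ζ / 2‖) := by
      rw [← mul_assoc]
      exact le_mul_of_one_le_left (norm_nonneg _) h4
    have h7 : B * (δ / 4 / B * ‖ζ‖) = δ / 4 * ‖ζ‖ := by field_simp
    exact h6.trans ((mul_le_mul_of_nonneg_left h5 hB.le).trans h7.le)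
  have hφx : ‖(φ x * ζ / 2 : ℂ)‖ ≤ 1 / 18 * ‖ζ‖ := by
    rw [norm_div, norm_mul, Complex.norm_real, Real.norm_eq_abs]
    norm_num
    nlinarith [hs.bound x]
  have h2 : ‖κ - 1‖ ≤ ‖ζ‖ / 2 := by
    have : κ - 1 = (κ - 1 - φ x * ζ / 2) + φ x * ζ / 2 := by ring
    rw [this]
    refine (norm_add_le _ _).trans ?_
    nlinarith
  have hκ2 : 1 / 2 ≤ ‖κ‖ := by
    have := norm_sub_norm_le (1 : ℂ) (1 - κ)
    rw [sub_sub_cancel, norm_one, norm_sub_rev] at this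
    linarith
  have hκ0 : κ ≠ 0 := norm_pos_iff.1 (by linarith)
  refine ⟨κ⁻¹, by rw [hκe, mul_inv_cancel_right₀ hκ0], ?_⟩
  have h3 : κ⁻¹ - 1 + φ x * ζ / 2 =
      (-(κ - 1 - φ x * ζ / 2) + φ x * ζ / 2 * (κ - 1)) / κ := by
    field_simp; ring
  rw [h3, norm_div, div_le_iff₀ (by linarith)]
  refine (norm_add_le _ _).trans ?_
  rw [norm_neg, norm_mul]
  have h4 : ‖(φ x * ζ / 2 : ℂ)‖ * ‖κ - 1‖ ≤ 1 / 18 * ‖ζ‖ * (‖ζ‖ / 2) :=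
    mul_le_mul hφx h2 (norm_nonneg _) (by positivity)
  have h5 : δ * ‖ζ‖ * (1 / 2) ≤ δ * ‖ζ‖ * ‖κ‖ := by gcongr
  nlinarith

/-- Perturbation of a real orbit: up to a small error, the inverse of the relative deviation of the
complex orbit from the linearized one varies linearly. -/
theorem LogSmooth.iterate_perturbation (hs : LogSmooth u d φ) {G : ℂ → ℂ}
    (hreal : ∀ x : ℝ, G x = (((u : CircleDeg1Lift) x : ℝ) : ℂ)) {ρ δ : ℝ}
    (hstep : ∀ (x : ℝ) (ζ : ℂ), ‖ζ‖ ≤ ρ →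
      ∃ t : ℂ, (G (x + ζ) - G x) * t = d x * ζ ∧ ‖t - 1 + φ x * ζ / 2‖ ≤ δ * ‖ζ‖)
    {N : ℕ} {ε η Y θ : ℝ} (hε : 0 ≤ ε) (hη0 : 0 ≤ η) (hδ : 0 ≤ δ) (hθ : Y * (ε / 2 + δ) ≤ θ) (hθ2 : θ ≤ 1 / 2)
    (hη : 2 * Y * η ≤ ρ) (x : ℝ) (hsum : ∀ j ≤ N, |orbitSum u d j φ x| ≤ ε * orbitTotal u d N x)
    (hder : ∀ j ≤ N, orbitDeriv u d j x ≤ η * orbitTotal u d N x) (ζ : ℂ)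
    (hζ : ‖ζ‖ * orbitTotal u d N x ≤ Y) {j : ℕ} (hj : j ≤ N) :
    ‖G^[j] (x + ζ) - (orbit u j x : ℝ) - orbitDeriv u d j x * ζ‖ ≤
        2 * θ * (orbitDeriv u d j x * ‖ζ‖) ∧
      ‖G^[j] (x + ζ) - (orbit u j x : ℝ)‖ ≤ ρ := by
  -- An estimate of s yields both conclusions; the bound by ρ is what allows the next step of the
  -- induction.
  have conc : ∀ j ≤ N, ∀ s : ℂ,
      (G^[j] (x + ζ) - (orbit u j x : ℝ)) * s = orbitDeriv u d j x * ζ →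
      ‖s - 1 + ζ * orbitSum u d j φ x / 2‖ ≤ δ * (‖ζ‖ * orbitTotal u d j x) →
      ‖G^[j] (x + ζ) - (orbit u j x : ℝ) - orbitDeriv u d j x * ζ‖ ≤
        2 * θ * (orbitDeriv u d j x * ‖ζ‖) ∧
      ‖G^[j] (x + ζ) - (orbit u j x : ℝ)‖ ≤ ρ := by
    intro j hj s hs1 hs2
    have hD := hs.orbitDeriv_pos j x
    have h1 : ‖(ζ * orbitSum u d j φ x / 2 : ℂ)‖ ≤ ‖ζ‖ * (ε * orbitTotal u d N x) / 2 := by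
      rw [norm_div, norm_mul, Complex.norm_real, Real.norm_eq_abs, Complex.norm_ofNat]
      have := mul_le_mul_of_nonneg_left (hsum j hj) (norm_nonneg ζ)
      linarith
    have h2 : ‖s - 1‖ ≤ θ := by
      have e : s - 1 = (s - 1 + ζ * orbitSum u d j φ x / 2) - ζ * orbitSum u d j φ x / 2 := by
        ring
      rw [e]
      refine (norm_sub_le _ _).trans ((add_le_add hs2 h1).trans ?_)
      have h3 := mul_le_mul_of_nonneg_left (hs.orbitTotal_mono hj x) (norm_nonneg ζ)
      have h4 := mul_le_mul_of_nonneg_left h3 hδ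
      have h5 := mul_le_mul_of_nonneg_right hζ (show 0 ≤ ε / 2 + δ by positivity)
      nlinarith
    have h3 : 1 / 2 ≤ ‖s‖ := by
      have := norm_sub_norm_le (1 : ℂ) (1 - s)
      rw [sub_sub_cancel, norm_one, norm_sub_rev] at this
      linarith
    have h4 : ‖G^[j] (x + ζ) - (orbit u j x : ℝ)‖ ≤ 2 * (orbitDeriv u d j x * ‖ζ‖) := by
      have := congrArg norm hs1
      rw [norm_mul, norm_mul, Complex.norm_real, Real.norm_eq_abs, abs_of_pos hD] at this
      nlinarith [norm_nonneg (G^[j] (x + ζ) - (orbit u j x : ℝ))]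
    refine ⟨?_, h4.trans ?_⟩
    · have e : G^[j] (x + ζ) - (orbit u j x : ℝ) - orbitDeriv u d j x * ζ =
          (G^[j] (x + ζ) - (orbit u j x : ℝ)) * (1 - s) := by
        rw [← hs1]; ring
      rw [e, norm_mul, norm_sub_rev 1 s]
      have := mul_le_mul h4 h2 (norm_nonneg _) (by positivity)
      linarith
    · have h5 := mul_le_mul_of_nonneg_right (hder j hj) (norm_nonneg ζ)
      have h6 := mul_le_mul_of_nonneg_left hζ hη0
      linarith
  have main : ∀ j ≤ N, ∃ s : ℂ,
      (G^[j] (x + ζ) - (orbit u j x : ℝ)) * s = orbitDeriv u d j x * ζ ∧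
      ‖s - 1 + ζ * orbitSum u d j φ x / 2‖ ≤ δ * (‖ζ‖ * orbitTotal u d j x) := by
    intro j
    induction j with
    | zero => intro _; exact ⟨1, by simp, by simp [orbitSum, orbitTotal]⟩
    | succ j ih =>
      intro hj
      obtain ⟨s, hs1, hs2⟩ := ih (by omega)
      obtain ⟨t, ht1, ht2⟩ := hstep (orbit u j x) _ (conc j (by omega) s hs1 hs2).2
      rw [add_sub_cancel, hreal, ← orbit_natCast_succ, ← Function.iterate_succ_apply' G j] at ht1
      set w := G^[j] (x + ζ) - (orbit u j x : ℝ) with hw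
      refine ⟨t * s, ?_, ?_⟩
      · rw [← mul_assoc, ht1, mul_assoc, hs1, orbitDeriv_succ]
        push_cast; ring
      -- Since w · s is exactly Dg^j(x) ζ, the correction φ · w · s / 2 is the new term of the orbit
      -- sum, with no error, and the remainder is at most δ Dg^j(x) ‖ζ‖.
      · have e : t * s - 1 + ζ * orbitSum u d (j + 1) φ x / 2 =
            (s - 1 + ζ * orbitSum u d j φ x / 2) +
              (t - 1 + φ (orbit u j x) * w / 2) * s := by
          rw [orbitSum_succ]
          push_cast
          linear_combination -(φ (orbit u j x) : ℂ) / 2 * hs1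
        have h1 : orbitTotal u d (j + 1) x = orbitTotal u d j x + orbitDeriv u d j x :=
          Finset.sum_range_succ _ _
        rw [e, h1]
        refine (norm_add_le _ _).trans ?_
        have h2 : ‖(t - 1 + φ (orbit u j x) * w / 2) * s‖ ≤ δ * (orbitDeriv u d j x * ‖ζ‖) := by
          have h3 := congrArg norm hs1
          rw [norm_mul, norm_mul, Complex.norm_real, Real.norm_eq_abs,
            abs_of_pos (hs.orbitDeriv_pos j x)] at h3
          rw [norm_mul, ← h3, ← mul_assoc]
          exact mul_le_mul_of_nonneg_right ht2 (norm_nonneg _)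
        linarith
  obtain ⟨s, hs1, hs2⟩ := main j hj
  exact conc j hj s hs1 hs2

/-- For `n` large, the iterates of order at most `q_n` are almost affine on discs of radius
`Y / orbitTotal` centred on the real line, and the closest returns are close to translations. -/
theorem IsStripExtension.exists_almost_affine {Δ : ℝ} (hΔ : 0 < Δ) {G : ℂ → ℂ}
    (hG : IsStripExtension Δ u G) (hs : LogSmooth u d φ)
    (hα : Irrational (u : CircleDeg1Lift).translationNumber)
    (hd : ∀ x : ℝ, deriv G x = (d x : ℝ))
    (hφ : ∀ x : ℝ, deriv (deriv G) x = ((φ x * d x : ℝ) : ℂ)) {Y θ : ℝ} (hY : 0 < Y) (hθ : 0 < θ)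
    (hθ1 : θ ≤ 1) :
    ∃ n₀ : ℕ, ∀ n ≥ n₀, ∃ R : ℤ,
      (∀ (x : ℝ) (ζ : ℂ),
        ‖ζ‖ * orbitTotal u d (convDen (u : CircleDeg1Lift).translationNumber n) x ≤ Y →
        ∀ j ≤ convDen (u : CircleDeg1Lift).translationNumber n,
          ‖G^[j] (x + ζ) - (orbit u j x : ℝ) - orbitDeriv u d j x * ζ‖ ≤
            θ * (orbitDeriv u d j x * ‖ζ‖) ∧ G^[j] (x + ζ) ∈ strip Δ) ∧
      (∀ x, ∀ j ≤ convDen (u : CircleDeg1Lift).translationNumber n,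
        |orbitTotal u d (convDen (u : CircleDeg1Lift).translationNumber n) (orbit u j x) *
          orbitDeriv u d j x -
            orbitTotal u d (convDen (u : CircleDeg1Lift).translationNumber n) x| ≤
          θ * orbitTotal u d (convDen (u : CircleDeg1Lift).translationNumber n) x) ∧
      ∀ x, |orbit u (convDen (u : CircleDeg1Lift).translationNumber n) x - R - x| *
          orbitTotal u d (convDen (u : CircleDeg1Lift).translationNumber n) x ≤ 3 ∧
        |orbitDeriv u d (convDen (u : CircleDeg1Lift).translationNumber n) x - 1| ≤ θ := by
  obtain ⟨ρ, hρ, hρΔ, hstep⟩ := hG.exists_step hΔ hs hd hφ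
    (show 0 < min 1 (θ / (4 * Y)) by positivity) (min_le_left _ _)
  set ε := min (θ / (2 * Y)) (min (θ / 16) (θ ^ 2 / 96)) with hε
  have hεpos : 0 < ε := by positivity
  obtain ⟨n₁, h₁⟩ := hs.abs_orbitSum_le hα hεpos
  obtain ⟨n₂, h₂⟩ := hs.exists_orbitDeriv_le hα (show 0 < ρ / (2 * Y) by positivity)
  refine ⟨max 1 (max n₁ n₂), fun n hn => ?_⟩
  obtain ⟨Q, P, h⟩ := exists_approxPair hα (le_of_max_le_left hn)
  replace h₁ := h₁ n (le_of_max_le_left (le_of_max_le_right hn))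
  replace h₂ := h₂ n (le_of_max_le_right (le_of_max_le_right hn))
  have hone := h.abs_orbitDeriv_sub_one_le hs hα hθ hεpos
    ((min_le_right _ _).trans (min_le_left _ _)) ((min_le_right _ _).trans (min_le_right _ _)) h₁
  refine ⟨_, fun x ζ hζ j hj => ?_, fun x j hj => hs.abs_orbitTotal_orbit_sub_le hone hj x,
    fun x => ⟨h.abs_return_mul_orbitTotal_le hs hα x, hone x⟩⟩
  have hYθ : Y * (ε / 2 + min 1 (θ / (4 * Y))) ≤ θ / 2 := by
    have h3 : ε / 2 + min 1 (θ / (4 * Y)) ≤ θ / (2 * Y) / 2 + θ / (4 * Y) := by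
      have := min_le_left (θ / (2 * Y)) (min (θ / 16) (θ ^ 2 / 96))
      have := min_le_right 1 (θ / (4 * Y))
      linarith
    refine (mul_le_mul_of_nonneg_left h3 hY.le).trans (le_of_eq ?_)
    field_simp; norm_num
  obtain ⟨h3, h4⟩ := hs.iterate_perturbation hG.agrees hstep hεpos.le
    (show 0 ≤ ρ / (2 * Y) by positivity) (by positivity) hYθ
    (by linarith) (le_of_eq (by field_simp)) x (h₁ x) (h₂ x) ζ hζ hj
  refine ⟨by rwa [mul_div_cancel₀ _ two_ne_zero] at h3, ?_⟩
  have h5 := (Complex.abs_im_le_norm _).trans h4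
  rw [Complex.sub_im, Complex.ofReal_im, sub_zero] at h5
  exact lt_of_le_of_lt h5 hρΔ

/-! ### Radial curves and the Poincaré distance -/

theorem E_ofReal_sub (x b : ℝ) :
    E (x - b * Complex.I) = Circle.exp (2 * Real.pi * x) * (Real.exp (2 * Real.pi * b) : ℂ) := by
  rw [E, Circle.coe_exp, Complex.ofReal_exp, ← Complex.exp_add]
  congr 1
  push_cast
  linear_combination (-(2 * Real.pi * b) : ℂ) * Complex.I_sq

theorem exists_circle_lift {b : ℝ → ℝ} (hb : Continuous b) (hp : Function.Periodic b 1) :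
    ∃ r : C(Circle, ℝ), ∀ x : ℝ, r (Circle.exp (2 * Real.pi * x)) = 2 * Real.pi * b x := by
  have hc : Continuous hp.lift := continuous_quot_lift _ hb
  refine ⟨⟨fun t => 2 * Real.pi * hp.lift ((AddCircle.homeomorphCircle one_ne_zero).symm t),
    continuous_const.mul (hc.comp (Homeomorph.continuous _))⟩, fun x => ?_⟩
  have h1 : AddCircle.homeomorphCircle (T := (1 : ℝ)) one_ne_zero (x : AddCircle (1 : ℝ)) =
      Circle.exp (2 * Real.pi * x) := by
    rw [AddCircle.homeomorphCircle_apply, AddCircle.toCircle_apply_mk, div_one]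
  simp only [ContinuousMap.coe_mk]
  rw [← h1, Homeomorph.symm_apply_apply, Function.Periodic.lift_coe]

theorem exists_circle_exp_eq (t : Circle) : ∃ x : ℝ, Circle.exp (2 * Real.pi * x) = t := by
  refine ⟨Complex.arg t / (2 * Real.pi), ?_⟩
  rw [mul_div_cancel₀ _ (by positivity), Circle.exp_arg]

/-- The curve with logarithmic polar equation `r`. -/
def radialCurve (r : C(Circle, ℝ)) : C(Circle, ℂ) :=
  ⟨fun t => t * (Real.exp (r t) : ℂ), by fun_prop⟩

theorem norm_circle_mul_exp (t : Circle) (a : ℝ) : ‖(t * (Real.exp a : ℂ) : ℂ)‖ = Real.exp a := by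
  rw [norm_mul, Circle.norm_coe, one_mul, Complex.norm_real, Real.norm_eq_abs, Real.abs_exp]

theorem isExteriorJordanCurve_radialCurve {r : C(Circle, ℝ)} (hr : ∀ t, 0 < r t) :
    IsExteriorJordanCurve (radialCurve r) where
  injective := by
    intro t s hts
    change (t * (Real.exp (r t) : ℂ) : ℂ) = s * (Real.exp (r s) : ℂ) at hts
    have h1 := congrArg norm hts
    rw [norm_circle_mul_exp, norm_circle_mul_exp] at h1
    rw [h1] at hts
    exact Circle.ext (mul_right_cancel₀ (Complex.ofReal_ne_zero.2 (Real.exp_pos _).ne') hts)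
  exterior := fun t => by
    change 1 < ‖(t * (Real.exp (r t) : ℂ) : ℂ)‖
    rw [norm_circle_mul_exp]
    exact Real.one_lt_exp_iff.2 (hr t)
  homotopic := by
    refine ⟨⟨⟨⟨fun p => p.2 * (Real.exp ((1 - p.1) * r p.2) : ℂ), by fun_prop⟩, ?_, ?_⟩, ?_⟩⟩
    · intro t; simp [radialCurve]
    · intro t; simp; rfl
    · intro s t
      change 1 ≤ ‖(t * (Real.exp ((1 - s) * r t) : ℂ) : ℂ)‖
      rw [norm_circle_mul_exp]
      exact Real.one_le_exp (mul_nonneg (by linarith [s.2.2]) (hr t).le)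

/-- A point beyond the curve on its ray is joined to infinity by the rest of the ray, so its
component is unbounded. -/
theorem norm_le_of_mem_jordanInterior {r : C(Circle, ℝ)} {t : Circle} {a : ℝ}
    (h : (t * (Real.exp a : ℂ) : ℂ) ∈ jordanInterior (Set.range (radialCurve r))) : a ≤ r t := by
  by_contra! hlt
  obtain ⟨-, hbdd⟩ := h
  set f : ℝ → ℂ := fun c => t * (Real.exp c : ℂ) with hf
  have hfc : Continuous f := by fun_prop
  have hsub : f '' Set.Ici a ⊆ (Set.range (radialCurve r))ᶜ := by
    rintro _ ⟨c, hc, rfl⟩ ⟨s, hs⟩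
    change (s * (Real.exp (r s) : ℂ) : ℂ) = t * (Real.exp c : ℂ) at hs
    have h1 := congrArg norm hs
    rw [norm_circle_mul_exp, norm_circle_mul_exp] at h1
    rw [h1] at hs
    have h2 : s = t :=
      Circle.ext (mul_right_cancel₀ (Complex.ofReal_ne_zero.2 (Real.exp_pos _).ne') hs)
    rw [h2] at h1
    have h3 := Real.exp_injective h1
    have h4 : a ≤ c := hc
    linarith
  have hconn := (isPreconnected_Ici.image f hfc.continuousOn).subset_connectedComponentIn
    (Set.mem_image_of_mem f (Set.self_mem_Ici (a := a))) hsub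
  obtain ⟨M, hM⟩ := (hbdd.subset hconn).exists_norm_le
  set c := max a M
  have h1 := hM (f c) (Set.mem_image_of_mem f (le_max_left a M))
  rw [hf, norm_circle_mul_exp] at h1
  have h2 := Real.add_one_le_exp c
  have h3 : M ≤ c := le_max_right a M
  linarith

theorem closure_annulusBelow_radialCurve_subset (r : C(Circle, ℝ)) :
    closure (annulusBelow (Set.range (radialCurve r))) ⊆
      (fun p : ℝ × Circle => (p.2 * (Real.exp (p.1 * r p.2) : ℂ) : ℂ)) ''
        (Set.Icc 0 1 ×ˢ Set.univ) := by
  have hcont : Continuous fun p : ℝ × Circle => (p.2 * (Real.exp (p.1 * r p.2) : ℂ) : ℂ) := by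
    fun_prop
  refine closure_minimal ?_
    ((isCompact_Icc.prod isCompact_univ).image hcont).isClosed
  rintro z ⟨hz1, hz2⟩
  have hz3 : 1 < ‖z‖ := by
    rw [Metric.mem_closedBall, dist_zero_right, not_le] at hz2
    exact hz2
  have hz0 : 0 < ‖z‖ := by linarith
  obtain ⟨t, ht⟩ : ∃ t : Circle, (t * (Real.exp (Real.log ‖z‖) : ℂ) : ℂ) = z := by
    refine ⟨Circle.exp (Complex.arg z), ?_⟩
    rw [Real.exp_log hz0, Circle.coe_exp, mul_comm]
    exact Complex.norm_mul_exp_arg_mul_I z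
  rw [← ht] at hz1
  have h1 := norm_le_of_mem_jordanInterior hz1
  have h2 : 0 < Real.log ‖z‖ := Real.log_pos hz3
  have h3 : 0 < r t := h2.trans_le h1
  refine ⟨(Real.log ‖z‖ / r t, t), ⟨⟨by positivity, (div_le_one h3).2 h1⟩, Set.mem_univ _⟩, ?_⟩
  simp only
  rw [div_mul_cancel₀ _ h3.ne', ht]

theorem exists_curve_of_height {b : ℝ → ℝ} (hb : Continuous b) (hp : Function.Periodic b 1)
    (hpos : ∀ x, 0 < b x) :
    ∃ γ : C(Circle, ℂ), IsExteriorJordanCurve γ ∧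
      Set.range γ = Set.range (fun x : ℝ => E (x - b x * Complex.I)) ∧
      closure (annulusBelow (Set.range γ)) ⊆
        {z | ∃ x s : ℝ, s ∈ Set.Icc (0 : ℝ) 1 ∧ E (x - (s * b x : ℝ) * Complex.I) = z} := by
  obtain ⟨r, hr⟩ := exists_circle_lift hb hp
  have hpt : ∀ (x : ℝ), radialCurve r (Circle.exp (2 * Real.pi * x)) =
      E (x - b x * Complex.I) := by
    intro x
    rw [E_ofReal_sub, ← hr]
    rfl
  refine ⟨radialCurve r, isExteriorJordanCurve_radialCurve fun t => ?_, ?_, ?_⟩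
  · obtain ⟨x, rfl⟩ := exists_circle_exp_eq t
    rw [hr]
    have := hpos x
    positivity
  · ext z
    constructor
    · rintro ⟨t, rfl⟩
      obtain ⟨x, rfl⟩ := exists_circle_exp_eq t
      exact ⟨x, (hpt x).symm⟩
    · rintro ⟨x, rfl⟩
      exact ⟨_, hpt x⟩
  · refine (closure_annulusBelow_radialCurve_subset r).trans ?_
    rintro _ ⟨⟨s, t⟩, ⟨hs, -⟩, rfl⟩
    obtain ⟨x, rfl⟩ := exists_circle_exp_eq t
    refine ⟨x, s, hs, ?_⟩
    simp only
    rw [E_ofReal_sub, hr]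
    congr 3
    ring_nf

/-! ### The covering `E` and the Poincaré distance -/

theorem isOpenMap_E : IsOpenMap E := by
  refine isOpenMap_iff_nhds_le.2 fun z => ?_
  have h1 : HasStrictDerivAt E (E z * (2 * Real.pi * Complex.I)) z := by
    have := ((hasStrictDerivAt_id z).const_mul (2 * Real.pi * Complex.I : ℂ)).cexp
    rwa [mul_one] at this
  exact (h1.map_nhds_eq (mul_ne_zero (Complex.exp_ne_zero _) Complex.two_pi_I_ne_zero)).ge

theorem annulusMap_iterate_E {Δ : ℝ} {g : CircleDeg1Lift} {G : ℂ → ℂ}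
    (h : IsStripExtension Δ g G) {z : ℂ} {j : ℕ} (hz : ∀ i < j, G^[i] z ∈ strip Δ) :
    (annulusMap G)^[j] (E z) = E (G^[j] z) := by
  induction j with
  | zero => rfl
  | succ j ih =>
    rw [Function.iterate_succ_apply', ih fun i hi => hz i (by omega),
      annulusMap_E h (hz j (by omega)), Function.iterate_succ_apply']

theorem poincareEDist_E_le {z w : ℂ} {b κ : ℝ} (hb : 0 < b) (hz : z.im = -b) (hκ : κ ≤ 1 / 2)
    (h : ‖w - z‖ ≤ κ * b) : poincareEDist (E w) (E z) ≤ ENNReal.ofReal (2 * κ) := by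
  have hκ0 : 0 ≤ κ := by
    by_contra! hneg
    have := (norm_nonneg _).trans h
    nlinarith
  have him := abs_le.1 ((Complex.abs_im_le_norm (w - z)).trans h)
  rw [Complex.sub_im, hz] at him
  have hw : b / 2 ≤ (-w).im := by
    rw [Complex.neg_im]; nlinarith [him.2]
  have hz' : (-z).im = b := by rw [Complex.neg_im, hz, neg_neg]
  refine (iInf_le_of_le (⟨-w, by linarith⟩ : UpperHalfPlane) <|
    iInf_le_of_le (⟨-z, by linarith⟩ : UpperHalfPlane) <|
    iInf_le_of_le (congrArg E (neg_neg w)) <| iInf_le_of_le (congrArg E (neg_neg z)) le_rfl).trans ?_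
  rw [edist_dist]
  refine ENNReal.ofReal_le_ofReal ((UpperHalfPlane.dist_le_dist_coe_div_sqrt _ _).trans ?_)
  have h1 : b / 2 ≤ √((-w).im * (-z).im) := by
    refine Real.le_sqrt_of_sq_le ?_
    rw [hz']
    nlinarith
  have h2 : dist (-w) (-z) = ‖w - z‖ := by
    rw [dist_eq_norm, neg_sub_neg, norm_sub_rev]
  change dist (-w) (-z) / √((-w).im * (-z).im) ≤ _
  rw [h2, div_le_iff₀ (by linarith)]
  nlinarith

/-! ### Estimates relative to the height of the curve -/

section Distances

variable {S Sj D Y θ : ℝ}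

/-- The near invariance of S gives D · Y/S ≈ Y/Sj with relative error θ; the affine error is at most
2θ, since D · Y/S ≤ 2Y/Sj. -/
theorem norm_sub_curve_point_le (hS : 0 < S) (hSj : 0 < Sj) (hY : 0 < Y)
    (hθ0 : 0 ≤ θ) (hθ1 : θ ≤ 1) (hSD : |Sj * D - S| ≤ θ * S) {w : ℂ} {y : ℝ}
    (hw : ‖w - y - D * (-(Y / S : ℝ) * Complex.I)‖ ≤ θ * (D * (Y / S))) :
    ‖w - (y - (Y / Sj : ℝ) * Complex.I)‖ ≤ 3 * θ * (Y / Sj) := by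
  have h1 : |D * (Y / S) - Y / Sj| ≤ θ * (Y / Sj) := by
    have e : D * (Y / S) - Y / Sj = (Sj * D - S) * (Y / (S * Sj)) := by field_simp
    have e2 : θ * S * (Y / (S * Sj)) = θ * (Y / Sj) := by field_simp
    rw [e, abs_mul, abs_of_pos (show 0 < Y / (S * Sj) by positivity), ← e2]
    exact mul_le_mul_of_nonneg_right hSD (by positivity)
  have h2 : w - (y - (Y / Sj : ℝ) * Complex.I) = (w - y - D * (-(Y / S : ℝ) * Complex.I)) -
      ((D * (Y / S) - Y / Sj : ℝ) : ℂ) * Complex.I := by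
    push_cast; ring
  have h3 : D * (Y / S) ≤ 2 * (Y / Sj) := by
    have := (abs_le.1 h1).2
    have h4 : 0 < Y / Sj := by positivity
    nlinarith
  rw [h2]
  refine (norm_sub_le _ _).trans ?_
  rw [norm_mul, Complex.norm_I, mul_one, Complex.norm_real, Real.norm_eq_abs]
  nlinarith

/-- The real displacement 3/S is the fraction 3/Y of the height, small for large Y; the affine error
gives 2θ and the derivative θ. -/
theorem norm_sub_return_le (hS : 0 < S) (hY : 0 < Y) (hθ0 : 0 ≤ θ) (hθ1 : θ ≤ 1)
    (hD : |D - 1| ≤ θ) {w : ℂ} {x y R : ℝ}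
    (hw : ‖w - y - D * (-(Y / S : ℝ) * Complex.I)‖ ≤ θ * (D * (Y / S)))
    (hy : |y - R - x| * S ≤ 3) :
    ‖w - (x - (Y / S : ℝ) * Complex.I + R)‖ ≤ (3 * θ + 3 / Y) * (Y / S) := by
  have h2 : w - (x - (Y / S : ℝ) * Complex.I + R) = (w - y - D * (-(Y / S : ℝ) * Complex.I)) +
      (((y - R - x : ℝ) : ℂ) - (((D - 1) * (Y / S) : ℝ) : ℂ) * Complex.I) := by
    push_cast; ring
  have hYS : 0 < Y / S := by positivity
  have h3 : |y - R - x| ≤ 3 / Y * (Y / S) := by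
    have : 3 / Y * (Y / S) = 3 / S := by field_simp
    rw [this, le_div_iff₀ hS]
    exact hy
  have hD2 := (abs_le.1 hD).2
  rw [h2]
  refine (norm_add_le _ _).trans ((add_le_add hw (norm_sub_le _ _)).trans ?_)
  rw [norm_mul, Complex.norm_I, mul_one, Complex.norm_real, Complex.norm_real, Real.norm_eq_abs,
    Real.norm_eq_abs, abs_mul, abs_of_pos hYS]
  have h4 := mul_le_mul_of_nonneg_right hD hYS.le
  have h5 : D * (Y / S) ≤ 2 * (Y / S) := mul_le_mul_of_nonneg_right (by linarith) hYS.le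
  have h6 := mul_le_mul_of_nonneg_left h5 hθ0
  linarith

end Distances

/-- Quasi-invariant curves: the curve of height `Y / orbitTotal`. -/
theorem IsStripExtension.exists_quasiInvariant_curve {Δ : ℝ} (hΔ : 0 < Δ) {G : ℂ → ℂ}
    (hG : IsStripExtension Δ u G) (hs : LogSmooth u d φ)
    (hα : Irrational (u : CircleDeg1Lift).translationNumber)
    (hd : ∀ x : ℝ, deriv G x = (d x : ℝ))
    (hφ : ∀ x : ℝ, deriv (deriv G) x = ((φ x * d x : ℝ) : ℂ)) {C₀ : ℝ} (hC₀ : 0 < C₀) :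
    ∃ n₀ : ℕ, ∀ n : ℕ, n₀ ≤ n → ∃ γ : C(Circle, ℂ),
      IsExteriorJordanCurve γ ∧
      (∃ W : Set ℂ, IsOpen W ∧ closure (annulusBelow (Set.range γ)) ⊆ W ∧
        ∀ z ∈ W, ∀ j < convDen (u : CircleDeg1Lift).translationNumber n,
          (annulusMap G)^[j] z ∈ annulus Δ) ∧
      (∀ j ≤ convDen (u : CircleDeg1Lift).translationNumber n,
        poincareHausdorffEDist ((annulusMap G)^[j] '' Set.range γ) (Set.range γ)
            ≤ ENNReal.ofReal C₀) ∧
      (∀ z ∈ Set.range γ,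
        poincareEDist ((annulusMap G)^[convDen (u : CircleDeg1Lift).translationNumber n] z) z
            ≤ ENNReal.ofReal C₀) := by
  set c : ℝ := min (C₀ / 2) (1 / 2) with hc
  have hc0 : 0 < c := by positivity
  have hcC : 2 * c ≤ C₀ := by linarith [min_le_left (C₀ / 2) (1 / 2)]
  have hc2 : c ≤ 1 / 2 := min_le_right _ _
  -- With θ = c/6, both 3θ and 3/Y equal c/2.
  set Y : ℝ := 6 / c with hYdef
  set θ : ℝ := c / 6 with hθdef
  have hY : 0 < Y := by positivity
  have hθ : 0 < θ := by positivity
  have hθ1 : θ ≤ 1 := by linarith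
  have h3θ : 3 * θ ≤ c := by linarith
  have hsumc : 3 * θ + 3 / Y = c := by rw [hYdef, hθdef]; field_simp; norm_num
  -- Control up to twice the height of the curve leaves room for an open neighbourhood of the closed
  -- annulus.
  obtain ⟨n₀, hn₀⟩ := hG.exists_almost_affine hΔ hs hα hd hφ (show 0 < 2 * Y by positivity) hθ hθ1
  refine ⟨n₀, fun n hn => ?_⟩
  obtain ⟨R, haff, hinv, hret⟩ := hn₀ n hn
  have hN : 0 < convDen (u : CircleDeg1Lift).translationNumber n := convDen_pos _ _
  set N := convDen (u : CircleDeg1Lift).translationNumber n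
  have hS := hs.orbitTotal_pos hN
  have hSc := hs.continuous_orbitTotal N
  set b : ℝ → ℝ := fun x => Y / orbitTotal u d N x with hb
  have hbpos : ∀ x, 0 < b x := fun x => div_pos hY (hS x)
  have hbS : ∀ x, b x * orbitTotal u d N x = Y := fun x => div_mul_cancel₀ _ (hS x).ne'
  have hbc : Continuous b := continuous_const.div hSc fun x => (hS x).ne'
  have hbp : Function.Periodic b 1 := fun x => by
    have := hs.orbitTotal_add_int N x 1
    push_cast at this
    simp only [hb, this]
  obtain ⟨γ, hγ, hrange, hclos⟩ := exists_curve_of_height hbc hbp hbpos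
  have hstrip : ∀ (x v : ℝ), |v| < 2 * b x → ∀ j ≤ N, G^[j] (x + v * Complex.I) ∈ strip Δ := by
    intro x v hv j hj
    refine (haff x _ ?_ j hj).2
    rw [norm_mul, Complex.norm_I, mul_one, Complex.norm_real, Real.norm_eq_abs, ← hbS x,
      ← mul_assoc]
    exact mul_le_mul_of_nonneg_right hv.le (hS x).le
  have hcurve : ∀ x : ℝ, (x - b x * Complex.I : ℂ) = x + (-(b x) : ℝ) * Complex.I := by
    intro x; push_cast; ring
  have habs : ∀ x, |-(b x)| < 2 * b x := fun x => by
    rw [abs_neg, abs_of_pos (hbpos x)]; linarith [hbpos x]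
  have hiter : ∀ x : ℝ, ∀ j ≤ N,
      (annulusMap G)^[j] (E (x - b x * Complex.I)) = E (G^[j] (x - b x * Complex.I)) := by
    intro x j hj
    refine annulusMap_iterate_E hG fun i hi => ?_
    rw [hcurve]
    exact hstrip x _ (habs x) i (by omega)
  have hnear : ∀ x : ℝ, ∀ j ≤ N, ‖G^[j] (x - b x * Complex.I) - (orbit u j x : ℝ) -
      orbitDeriv u d j x * (-(b x : ℝ) * Complex.I)‖ ≤ θ * (orbitDeriv u d j x * b x) := by
    intro x j hj
    have hnorm : ‖(-(b x : ℝ) * Complex.I : ℂ)‖ = b x := by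
      rw [norm_mul, Complex.norm_I, mul_one, norm_neg, Complex.norm_real, Real.norm_eq_abs,
        abs_of_pos (hbpos x)]
    have h1 := (haff x (-(b x : ℝ) * Complex.I) (by rw [hnorm, hbS]; linarith) j hj).1
    rw [hnorm] at h1
    have e : (x - b x * Complex.I : ℂ) = x + -(b x : ℝ) * Complex.I := by ring
    rw [e]
    exact h1
  have him : ∀ x : ℝ, (x - b x * Complex.I : ℂ).im = -(b x) := by intro x; simp
  have hdist : ∀ x : ℝ, ∀ j ≤ N, poincareEDist ((annulusMap G)^[j] (E (x - b x * Complex.I)))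
      (E ((orbit u j x : ℝ) - b (orbit u j x) * Complex.I)) ≤ ENNReal.ofReal C₀ := by
    intro x j hj
    rw [hiter x j hj]
    refine (poincareEDist_E_le (hbpos (orbit u j x)) (him _) (show 3 * θ ≤ 1 / 2 by linarith)
      (norm_sub_curve_point_le (hS x) (hS _) hY hθ.le hθ1 (hinv x j hj)
        (hnear x j hj))).trans (ENNReal.ofReal_le_ofReal (by linarith))
  refine ⟨γ, hγ, ⟨E '' {z | |z.im| < 2 * b z.re}, ?_, ?_, ?_⟩, fun j hj => ?_, ?_⟩
  · refine isOpenMap_E _ (isOpen_lt (by fun_prop) ?_)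
    exact continuous_const.mul (hbc.comp Complex.continuous_re)
  · refine hclos.trans ?_
    rintro z ⟨x, s, hs', rfl⟩
    refine ⟨_, ?_, rfl⟩
    have h1 := hbpos x
    have h2 : 0 ≤ s * b x := mul_nonneg hs'.1 h1.le
    have h3 : s * b x ≤ b x := mul_le_of_le_one_left h1.le hs'.2
    have e1 : (x - (s * b x : ℝ) * Complex.I : ℂ).im = -(s * b x) := by simp
    have e2 : (x - (s * b x : ℝ) * Complex.I : ℂ).re = x := by simp
    rw [Set.mem_ofPred_eq, e1, e2, abs_neg, abs_of_nonneg h2]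
    linarith
  · rintro _ ⟨z, hz, rfl⟩ j hj
    have h1 : ∀ i ≤ N, G^[i] z ∈ strip Δ := by
      intro i hi
      have := hstrip z.re z.im hz i hi
      rwa [Complex.re_add_im] at this
    rw [annulusMap_iterate_E hG fun i hi => h1 i (by omega)]
    exact ⟨_, h1 j hj.le, rfl⟩
  · rw [hrange]
    refine max_le (iSup₂_le ?_) (iSup₂_le ?_)
    · rintro _ ⟨_, ⟨x, rfl⟩, rfl⟩
      exact (iInf₂_le _ ⟨orbit u j x, rfl⟩).trans (hdist x j hj)
    · rintro _ ⟨y, rfl⟩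
      -- The curve point over y is approximated by the image of the one over g^{-j} y.
      refine (iInf₂_le _ ⟨_, ⟨orbit u (-j) y, rfl⟩, rfl⟩).trans ?_
      have := hdist (orbit u (-j) y) j hj
      rwa [orbit_orbit_neg] at this
  · rw [hrange]
    rintro _ ⟨x, rfl⟩
    simp only
    -- The return is close to the translate by R, which has the same image under `E`.
    rw [hiter x N le_rfl, ← E_add_intCast (x - b x * Complex.I) R]
    refine (poincareEDist_E_le (hbpos x) ?_ (hsumc.trans_le hc2) ?_).trans
      (ENNReal.ofReal_le_ofReal (by linarith))
    · simp
    · exact norm_sub_return_le (R := R) (hS x) hY hθ.le hθ1 (hret x).2 (hnear x N le_rfl) (hret x).1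

end CircleDiffeo

end

theorem mainTheorem4
    (Δ : ℝ) (hΔ : 0 < Δ)
    (g : CircleDeg1Lift) (hg : CircleDiffeo.IsAnalyticDiffeo g)
    (hα : Irrational g.translationNumber)
    (G : ℂ → ℂ) (hG : CircleDiffeo.IsStripExtension Δ g G)
    (hτ : ∃ τ : ℝ, τ < 1 / 9 ∧ ∀ z ∈ CircleDiffeo.strip Δ, ‖logDeriv (deriv G) z‖ ≤ τ)
    (C₀ : ℝ) (hC₀ : 0 < C₀) :
    ∃ (n₀ : ℕ) (γ : ℕ → C(Circle, ℂ)), ∀ n : ℕ, n₀ ≤ n →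
      CircleDiffeo.IsExteriorJordanCurve (γ n) ∧
      -- all iterates up to order `q_n` are defined on a neighbourhood of the closed annulus
      (∃ W : Set ℂ, IsOpen W ∧
        closure (CircleDiffeo.annulusBelow (Set.range (γ n))) ⊆ W ∧
        ∀ z ∈ W, ∀ j < CircleDiffeo.convDen g.translationNumber n,
          (CircleDiffeo.annulusMap G)^[j] z ∈ CircleDiffeo.annulus Δ) ∧
      (∀ j ≤ CircleDiffeo.convDen g.translationNumber n,
        CircleDiffeo.poincareHausdorffEDist
          ((CircleDiffeo.annulusMap G)^[j] '' Set.range (γ n)) (Set.range (γ n))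
            ≤ ENNReal.ofReal C₀) ∧
      (∀ z ∈ Set.range (γ n),
        CircleDiffeo.poincareEDist
          ((CircleDiffeo.annulusMap G)^[CircleDiffeo.convDen g.translationNumber n] z) z
            ≤ ENNReal.ofReal C₀) := by
  obtain ⟨u, d, φ, rfl, hs, hd, hφ⟩ := hG.exists_logSmooth hΔ hg hτ
  obtain ⟨n₀, h⟩ := hG.exists_quasiInvariant_curve hΔ hs hα hd hφ hC₀
  choose! γ hγ using h
  exact ⟨n₀, γ, hγ⟩
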